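/- Let $a>0$ and let $V:[-a,a]\to\mathbb R$ be even, continuous except at finitely many points, and essentially bounded. Let $AC^2[-a,a]$ be the set of differentiable $f:[-a,a]\to\mathbb C$ (one-sidedly at $\pm a$) such that $f'$ is absolutely continuous and $f''\in L^2[-a,a]$. Let $A=-\frac{d^2}{dx^2}+V$ on $\mathcal H=L^2[-a,a]$ with domain $\{f\in AC^2[-a,a] : f(\pm a)=f'(\pm a)=0\}$, let $\bar A$ be its closure, $A^\dagger$ its adjoint and $\mathscr K_\pm=\ker(A^\dagger\mp i)$. There exist functions $g_+,g_-\in AC^2[-a,a]$, with $g_+$ even and $g_-$ odd, of $L^2$-norm $1$, satisfying $-g''+Vg=ig$ almost everywhere. For any such $g_+,g_-$, put $\mathcal A=\mathrm{diag}(g_+(a),g_-(a))$, $\mathcal B=\mathrm{diag}(g_+'(a),g_-'(a))$ and, for $U\in M_2(\mathbb C)$ with entrywise complex conjugate $\overline U$, $$M_\mp(U)=\overline{\mathcal A}\mp i\overline{\mathcal B}+\overline U(\mathcal A\mp i\mathcal B),\qquad \mathcal U(U)=-\frac12\begin{pmatrix}1&1\\-1&1\end{pmatrix}M_-(U)^{-1}M_+(U)\begin{pmatrix}1&-1\\1&1\end{pmatrix},$$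 where $\mathcal U(U)$ is defined whenever $M_-(U)$ is invertible. Then: 1. If $U$ is unitary, then $M_-(U)$ and $M_+(U)$ are both invertible. 2. Whenever $M_-(U)$ is invertible, $\mathcal U(U)$ is unitary if and only if $U$ is unitary. 3. $U\mapsto\mathcal U(U)$ is a bijection of the unitary group $U(2)$ onto itself. 4. $(g_+,g_-)$ and $(\overline{g_+},\overline{g_-})$ are orthonormal bases of $\mathscr K_+$ and $\mathscr K_-$. Write $g_1=g_+$, $g_2=g_-$. For $U=(u_{jk})\in M_2(\mathbb C)$ let $\Phi_U:\mathscr K_+\to\mathscr K_-$ be the linear map with $\Phi_U g_j=\sum_{k}u_{jk}\overline{g_k}$; it is norm-preserving if and only if $U$ is unitary. For unitary $U$ let $A_U$ be the von Neumann extension of $A$, that is, the restriction of $A^\dagger$ to $\{f_0+g+\Phi_Ug : f_0\in\mathrm{Dom}\,\bar A,\ g\in\mathscr K_+\}$, so that $A_U(f_0+g+\Phi_Ug)=A^\dagger f_0+ig-i\Phi_Ug$. Then $U\mapsto A_U$ is a bijection of $U(2)$ onto the set of all self-adjoint extensions of $A$. 5. For every unitary $U$, $\mathrm{Dom}\,A_U$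 is exactly the set of all $f\in AC^2[-a,a]$ satisfying $$\begin{pmatrix}f'(a)-if(a)\\ f'(-a)+if(-a)\end{pmatrix}=\mathcal U(U)\begin{pmatrix}f'(a)+if(a)\\ f'(-a)-if(-a)\end{pmatrix}.$$ -/

import Mathlib

open MeasureTheory Set
open scoped ENNReal LinearPMap Matrix

noncomputable section

namespace BoxSchrodinger

/-! ### Deficiency spaces and von Neumann extensions of an operator on a Hilbert space -/

section Abstract

variable {H : Type*} [NormedAddCommGroup H] [InnerProductSpace ℂ H] [CompleteSpace H]

/-- The space `Ker (T† - z)`: all `u` in the domain of `T†` with `T† u = z u`. -/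
def deficiencySpace (T : H →ₗ.[ℂ] H) (z : ℂ) : Submodule ℂ H where
  carrier := {u | ∃ h : u ∈ T†.domain, T† ⟨u, h⟩ = z • u}
  zero_mem' := ⟨T†.domain.zero_mem, by
    rw [smul_zero]
    exact T†.map_zero⟩
  add_mem' := by
    rintro u v ⟨hu, eu⟩ ⟨hv, ev⟩
    refine ⟨T†.domain.add_mem hu hv, ?_⟩
    rw [smul_add, ← eu, ← ev, ← T†.map_add]
    rfl
  smul_mem' := by
    rintro c u ⟨hu, eu⟩
    refine ⟨T†.domain.smul_mem c hu, ?_⟩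
    rw [smul_comm, ← eu, ← T†.map_smul]
    rfl

/-- The subspace `{f₀ + g + Φ g | f₀ ∈ Dom (closure of T), g ∈ Ker (T† - i)}`, for a linear map
`Φ : Ker (T† - i) → Ker (T† + i)`. -/
def vonNeumannDomain (T : H →ₗ.[ℂ] H)
    (Φ : deficiencySpace T Complex.I →ₗ[ℂ] deficiencySpace T (-Complex.I)) : Submodule ℂ H :=
  T.closure.domain ⊔ LinearMap.range
    ((deficiencySpace T Complex.I).subtype + (deficiencySpace T (-Complex.I)).subtype ∘ₗ Φ)

/-- The von Neumann extension of `T` given by `Φ`: the restriction of `T†` to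
`vonNeumannDomain T Φ`. The two lemmas below say that, for symmetric `T`, its domain is exactly
`vonNeumannDomain T Φ` and it maps `f₀ + g + Φ g` to `T† f₀ + i g - i Φ g`. -/
def vonNeumannExtension (T : H →ₗ.[ℂ] H)
    (Φ : deficiencySpace T Complex.I →ₗ[ℂ] deficiencySpace T (-Complex.I)) : H →ₗ.[ℂ] H :=
  T†.domRestrict (vonNeumannDomain T Φ)

theorem closure_le_adjoint {T : H →ₗ.[ℂ] H} (hd : Dense (T.domain : Set H))
    (hs : T.IsFormalAdjoint T) : T.closure ≤ T† := by
  have hle : T ≤ T† := LinearPMap.IsFormalAdjoint.le_adjoint hd hs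
  have hc : T†.IsClosed := LinearPMap.adjoint_isClosed hd
  have h := LinearPMap.IsClosable.closure_mono hc.isClosable hle
  have e : T†.closure = T† := by
    apply LinearPMap.eq_of_eq_graph
    rw [← hc.isClosable.graph_closure_eq_closure_graph]
    exact IsClosed.submodule_topologicalClosure_eq hc
  rwa [e] at h

theorem vonNeumannExtension_domain {T : H →ₗ.[ℂ] H} (hd : Dense (T.domain : Set H))
    (hs : T.IsFormalAdjoint T)
    (Φ : deficiencySpace T Complex.I →ₗ[ℂ] deficiencySpace T (-Complex.I)) :
    (vonNeumannExtension T Φ).domain = vonNeumannDomain T Φ := by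
  refine inf_eq_left.mpr (sup_le (closure_le_adjoint hd hs).1 ?_)
  rintro _ ⟨g, rfl⟩
  exact T†.domain.add_mem g.2.choose (Φ g).2.choose

theorem vonNeumannExtension_apply {T : H →ₗ.[ℂ] H}
    (Φ : deficiencySpace T Complex.I →ₗ[ℂ] deficiencySpace T (-Complex.I))
    (f₀ : T†.domain) (g : deficiencySpace T Complex.I)
    (x : (vonNeumannExtension T Φ).domain) (hx : (x : H) = f₀ + g + Φ g) :
    vonNeumannExtension T Φ x =
      T† f₀ + Complex.I • (g : H) - Complex.I • (Φ g : H) := by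
  obtain ⟨hg, eg⟩ := g.2
  obtain ⟨hp, ep⟩ := (Φ g).2
  have h : vonNeumannExtension T Φ x = T† (f₀ + ⟨g, hg⟩ + ⟨Φ g, hp⟩) :=
    LinearPMap.domRestrict_apply (by simpa using hx)
  rw [h, T†.map_add, T†.map_add, eg, ep, neg_smul, sub_eq_add_neg]

end Abstract

/-! ### The minimal Schrödinger operator on `L²[-a, a]` -/

/-- Lebesgue measure on `[-a, a]`. -/
abbrev boxMeasure (a : ℝ) : Measure ℝ := volume.restrict (Icc (-a) a)

/-- The Hilbert space `L²[-a, a]`. -/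
abbrev BoxL2 (a : ℝ) : Type := Lp ℂ 2 (boxMeasure a)

/-- The derivative of `f` on `[-a, a]`, one-sided at the endpoints. -/
def d1 (a : ℝ) (f : ℝ → ℂ) : ℝ → ℂ := derivWithin f (Icc (-a) a)

/-- The second derivative of `f` on `[-a, a]`. -/
def d2 (a : ℝ) (f : ℝ → ℂ) : ℝ → ℂ := derivWithin (d1 a f) (Icc (-a) a)

/-- `AC²[-a, a]`: `f` is differentiable on `[-a, a]`, `f'` is absolutely continuous and `f''`
(which then exists almost everywhere) is square-integrable. -/
structure IsAC2 (a : ℝ) (f : ℝ → ℂ) : Prop where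
  differentiableOn : DifferentiableOn ℝ f (Icc (-a) a)
  absolutelyContinuous : AbsolutelyContinuousOnInterval (d1 a f) (-a) a
  memLp : MemLp (d2 a f) 2 (boxMeasure a)

/-- An even, real potential on `[-a, a]`, continuous except at finitely many points, which acts as a
bounded multiplication operator on `L²[-a, a]` (that is, which is essentially bounded). -/
structure IsPotential (a : ℝ) (V : ℝ → ℝ) : Prop where
  even : ∀ x ∈ Icc (-a) a, V (-x) = V x
  piecewise_continuous : ∃ S : Set ℝ, S.Finite ∧
    ∀ x ∈ Icc (-a) a \ S, ContinuousWithinAt V (Icc (-a) a) x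
  bounded : MemLp V ∞ (boxMeasure a)

/-- The formal differential expression `-f'' + V f`. -/
def formalOp (a : ℝ) (V : ℝ → ℝ) (f : ℝ → ℂ) : ℝ → ℂ := fun x => -d2 a f x + (V x : ℂ) * f x

variable {a : ℝ} {V : ℝ → ℝ} {f g : ℝ → ℂ}

theorem IsAC2.memLp_formalOp (hV : IsPotential a V) (hf : IsAC2 a f) :
    MemLp (formalOp a V f) 2 (boxMeasure a) := by
  have hc : ContinuousOn f (Icc (-a) a) := hf.differentiableOn.continuousOn
  obtain ⟨C, hC⟩ := isCompact_Icc.exists_bound_of_continuousOn hc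
  have h1 : MemLp f 2 (boxMeasure a) :=
    MemLp.of_bound (hc.aestronglyMeasurable measurableSet_Icc) C
      ((ae_restrict_iff' measurableSet_Icc).mpr (Filter.Eventually.of_forall hC))
  have h2 : MemLp (fun x => (V x : ℂ)) ∞ (boxMeasure a) := hV.bounded.ofReal
  exact hf.memLp.neg.add (h1.mul h2)

theorem IsAC2.ae_differentiableWithinAt (ha : 0 < a) (hf : IsAC2 a f) :
    ∀ᵐ x ∂boxMeasure a, x ∈ Icc (-a) a ∧ DifferentiableWithinAt ℝ (d1 a f) (Icc (-a) a) x := by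
  rw [ae_restrict_iff' measurableSet_Icc]
  filter_upwards [hf.absolutelyContinuous.boundedVariationOn.ae_differentiableAt_of_mem_uIcc]
    with x hx hxI
  refine ⟨hxI, (hx ?_).differentiableWithinAt⟩
  rwa [uIcc_of_le (by linarith)]

theorem IsAC2.eqOn_of_ae_eq (ha : 0 < a) (hf : IsAC2 a f) (hg : IsAC2 a g)
    (h : f =ᵐ[boxMeasure a] g) : EqOn f g (Icc (-a) a) :=
  Measure.eqOn_Icc_of_ae_eq volume (by linarith) h hf.differentiableOn.continuousOn
    hg.differentiableOn.continuousOn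

theorem formalOp_congr (h : EqOn f g (Icc (-a) a)) :
    EqOn (formalOp a V f) (formalOp a V g) (Icc (-a) a) := by
  have h1 : EqOn (d1 a f) (d1 a g) (Icc (-a) a) := fun y hy => derivWithin_congr h (h hy)
  intro x hx
  have h2 : d2 a f x = d2 a g x := derivWithin_congr h1 (h1 hx)
  simp only [formalOp, h2, h hx]

theorem IsAC2.d1_add (hf : IsAC2 a f) (hg : IsAC2 a g) :
    EqOn (d1 a (f + g)) (d1 a f + d1 a g) (Icc (-a) a) := fun x hx =>
  derivWithin_add (hf.differentiableOn x hx) (hg.differentiableOn x hx)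

theorem IsAC2.d1_smul (c : ℂ) (hf : IsAC2 a f) :
    EqOn (d1 a (c • f)) (c • d1 a f) (Icc (-a) a) := fun x hx =>
  derivWithin_const_smul c (hf.differentiableOn x hx)

theorem IsAC2.d2_add (ha : 0 < a) (hf : IsAC2 a f) (hg : IsAC2 a g) :
    d2 a (f + g) =ᵐ[boxMeasure a] d2 a f + d2 a g := by
  filter_upwards [hf.ae_differentiableWithinAt ha, hg.ae_differentiableWithinAt ha]
    with x ⟨hx, hx1⟩ ⟨_, hx2⟩
  have h := hf.d1_add hg
  exact (derivWithin_congr h (h hx)).trans (derivWithin_add hx1 hx2)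

theorem IsAC2.d2_smul (ha : 0 < a) (c : ℂ) (hf : IsAC2 a f) :
    d2 a (c • f) =ᵐ[boxMeasure a] c • d2 a f := by
  filter_upwards [hf.ae_differentiableWithinAt ha] with x ⟨hx, hx1⟩
  have h := hf.d1_smul c
  exact (derivWithin_congr h (h hx)).trans (derivWithin_const_smul c hx1)

theorem absolutelyContinuous_congr (ha : 0 < a) (h : EqOn f g (Icc (-a) a))
    (hg : AbsolutelyContinuousOnInterval g (-a) a) :
    AbsolutelyContinuousOnInterval f (-a) a := by
  rw [absolutelyContinuousOnInterval_iff] at hg ⊢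
  intro ε hε
  obtain ⟨δ, hδ, H⟩ := hg ε hε
  refine ⟨δ, hδ, fun E hE hs => ?_⟩
  have key := H E hE hs
  have hu : uIcc (-a) a = Icc (-a) a := uIcc_of_le (by linarith)
  convert key using 1
  refine Finset.sum_congr rfl fun i hi => ?_
  have := hE.1 i hi
  rw [hu] at this
  rw [h this.1, h this.2]

theorem IsAC2.add (ha : 0 < a) (hf : IsAC2 a f) (hg : IsAC2 a g) : IsAC2 a (f + g) where
  differentiableOn := hf.differentiableOn.add hg.differentiableOn
  absolutelyContinuous := absolutelyContinuous_congr ha (hf.d1_add hg)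
    (hf.absolutelyContinuous.add hg.absolutelyContinuous)
  memLp := (memLp_congr_ae (hf.d2_add ha hg)).mpr (hf.memLp.add hg.memLp)

theorem IsAC2.smul (ha : 0 < a) (c : ℂ) (hf : IsAC2 a f) : IsAC2 a (c • f) where
  differentiableOn := hf.differentiableOn.const_smul c
  absolutelyContinuous := absolutelyContinuous_congr ha (hf.d1_smul c)
    (hf.absolutelyContinuous.const_smul c)
  memLp := (memLp_congr_ae (hf.d2_smul ha c)).mpr (hf.memLp.const_smul c)

theorem isAC2_zero : IsAC2 a 0 := by
  have h1 : d1 a 0 = 0 := by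
    funext x
    exact congrFun (derivWithin_zero (𝕜 := ℝ) (F := ℂ) (s := Icc (-a) a)) x
  have h2 : d2 a 0 = 0 := by
    rw [d2, h1]
    exact h1
  refine ⟨differentiableOn_const 0, ?_, ?_⟩
  · rw [h1]
    exact (contDiff_const (c := (0 : ℂ))).contDiffOn.absolutelyContinuousOnInterval
  · rw [h2]
    exact MemLp.zero

theorem formalOp_add (ha : 0 < a) (hf : IsAC2 a f) (hg : IsAC2 a g) :
    formalOp a V (f + g) =ᵐ[boxMeasure a] formalOp a V f + formalOp a V g := by
  filter_upwards [hf.d2_add ha hg] with x hx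
  simp only [formalOp, hx, Pi.add_apply]
  ring

theorem formalOp_smul (ha : 0 < a) (c : ℂ) (hf : IsAC2 a f) :
    formalOp a V (c • f) =ᵐ[boxMeasure a] c • formalOp a V f := by
  filter_upwards [hf.d2_smul ha c] with x hx
  simp only [formalOp, hx, Pi.smul_apply, smul_eq_mul]
  ring

/-- `f ∈ AC²[-a, a]` with `f(±a) = f'(±a) = 0`. -/
structure IsMinimal (a : ℝ) (f : ℝ → ℂ) : Prop extends IsAC2 a f where
  right : f a = 0
  left : f (-a) = 0
  d1_right : d1 a f a = 0
  d1_left : d1 a f (-a) = 0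

/-- The domain of the minimal operator, as a subspace of `L²[-a, a]`. -/
def minimalDomain (ha : 0 < a) : Submodule ℂ (BoxL2 a) where
  carrier := {u | ∃ f, IsMinimal a f ∧ u =ᵐ[boxMeasure a] f}
  zero_mem' := by
    have h1 : d1 a 0 = 0 := by
      funext x
      exact congrFun (derivWithin_zero (𝕜 := ℝ) (F := ℂ) (s := Icc (-a) a)) x
    exact ⟨0, ⟨isAC2_zero, rfl, rfl, by rw [h1]; rfl, by rw [h1]; rfl⟩, Lp.coeFn_zero _ _ _⟩
  add_mem' := by
    rintro u v ⟨f, hf, huf⟩ ⟨g, hg, hvg⟩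
    have h := hf.toIsAC2.d1_add hg.toIsAC2
    refine ⟨f + g, ⟨hf.toIsAC2.add ha hg.toIsAC2, by simp [hf.right, hg.right],
      by simp [hf.left, hg.left], ?_, ?_⟩, (Lp.coeFn_add u v).trans (huf.add hvg)⟩
    · rw [h (right_mem_Icc.mpr (by linarith))]
      simp [hf.d1_right, hg.d1_right]
    · rw [h (left_mem_Icc.mpr (by linarith))]
      simp [hf.d1_left, hg.d1_left]
  smul_mem' := by
    rintro c u ⟨f, hf, huf⟩
    have h := hf.toIsAC2.d1_smul c
    refine ⟨c • f, ⟨hf.toIsAC2.smul ha c, by simp [hf.right], by simp [hf.left], ?_, ?_⟩,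
      (Lp.coeFn_smul c u).trans (huf.const_smul c)⟩
    · rw [h (right_mem_Icc.mpr (by linarith))]
      simp [hf.d1_right]
    · rw [h (left_mem_Icc.mpr (by linarith))]
      simp [hf.d1_left]

theorem formalOp_ae_eq (ha : 0 < a) (hf : IsAC2 a f) (hg : IsAC2 a g)
    (h : f =ᵐ[boxMeasure a] g) : formalOp a V f =ᵐ[boxMeasure a] formalOp a V g :=
  (ae_restrict_iff' measurableSet_Icc).mpr
    (Filter.Eventually.of_forall fun _ hx => formalOp_congr (hf.eqOn_of_ae_eq ha hg h) hx)

/-- The minimal operator `A = -d²/dx² + V` on `L²[-a, a]`, with domain the (classes of) functions in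
`AC²[-a, a]` with `f(±a) = f'(±a) = 0`. -/
def minimalOp (ha : 0 < a) (hV : IsPotential a V) : BoxL2 a →ₗ.[ℂ] BoxL2 a where
  domain := minimalDomain ha
  toFun :=
    { toFun := fun u => (u.2.choose_spec.1.toIsAC2.memLp_formalOp hV).toLp _
      map_add' := by
        intro u v
        obtain ⟨hu, eu⟩ := u.2.choose_spec
        obtain ⟨hv, ev⟩ := v.2.choose_spec
        obtain ⟨hw, ew⟩ := (u + v).2.choose_spec
        rw [← MemLp.toLp_add]
        refine MemLp.toLp_congr _ _ (.trans (formalOp_ae_eq ha hw.toIsAC2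
          (hu.toIsAC2.add ha hv.toIsAC2) ?_) (formalOp_add ha hu.toIsAC2 hv.toIsAC2))
        exact ew.symm.trans ((Lp.coeFn_add (u : BoxL2 a) v).trans (eu.add ev))
      map_smul' := by
        intro c u
        obtain ⟨hu, eu⟩ := u.2.choose_spec
        obtain ⟨hw, ew⟩ := (c • u).2.choose_spec
        rw [RingHom.id_apply, ← MemLp.toLp_const_smul]
        refine MemLp.toLp_congr _ _ (.trans (formalOp_ae_eq ha hw.toIsAC2
          (hu.toIsAC2.smul ha c) ?_) (formalOp_smul ha c hu.toIsAC2))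
        exact ew.symm.trans ((Lp.coeFn_smul c (u : BoxL2 a)).trans (eu.const_smul c)) }

/-- The minimal operator acts as `-f'' + V f`. -/
theorem minimalOp_apply (ha : 0 < a) (hV : IsPotential a V) (u : (minimalOp ha hV).domain)
    (hf : IsAC2 a f) (huf : (u : BoxL2 a) =ᵐ[boxMeasure a] f) :
    minimalOp ha hV u =ᵐ[boxMeasure a] formalOp a V f := by
  have hs := u.2.choose_spec
  refine (MemLp.coeFn_toLp (hs.1.toIsAC2.memLp_formalOp hV)).trans ?_
  exact formalOp_ae_eq ha hs.1.toIsAC2 hf (hs.2.symm.trans huf)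

/-! ### Deficiency solutions and boundary conditions -/

/-- `g ∈ AC²[-a, a]` is an `L²`-normalized solution of `-g'' + V g = i g`. -/
structure IsDeficiencySolution (a : ℝ) (V : ℝ → ℝ) (g : ℝ → ℂ) : Prop extends IsAC2 a g where
  equation : formalOp a V g =ᵐ[boxMeasure a] fun x => Complex.I * g x
  normalized : ∫ x, ‖g x‖ ^ 2 ∂boxMeasure a = 1

/-- `g₊` and `g₋` are normalized solutions of `-g'' + V g = i g`, even and odd respectively. -/
structure IsDeficiencyPair (a : ℝ) (V : ℝ → ℝ) (gp gm : ℝ → ℂ) : Prop where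
  plus : IsDeficiencySolution a V gp
  minus : IsDeficiencySolution a V gm
  even : ∀ x ∈ Icc (-a) a, gp (-x) = gp x
  odd : ∀ x ∈ Icc (-a) a, gm (-x) = -gm x

/-- Entrywise complex conjugate of a matrix. -/
def conjMatrix (M : Matrix (Fin 2) (Fin 2) ℂ) : Matrix (Fin 2) (Fin 2) ℂ := M.map (starRingEnd ℂ)

/-- `𝒜 = diag(g₊(a), g₋(a))`. -/
def matA (a : ℝ) (gp gm : ℝ → ℂ) : Matrix (Fin 2) (Fin 2) ℂ := !![gp a, 0; 0, gm a]

/-- `ℬ = diag(g₊'(a), g₋'(a))`. -/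
def matB (a : ℝ) (gp gm : ℝ → ℂ) : Matrix (Fin 2) (Fin 2) ℂ := !![d1 a gp a, 0; 0, d1 a gm a]

/-- The matrix `conj 𝒜 - i conj ℬ + conj U (𝒜 - i ℬ)`. -/
def matMinus (a : ℝ) (gp gm : ℝ → ℂ) (U : Matrix (Fin 2) (Fin 2) ℂ) :
    Matrix (Fin 2) (Fin 2) ℂ :=
  conjMatrix (matA a gp gm) - Complex.I • conjMatrix (matB a gp gm) +
    conjMatrix U * (matA a gp gm - Complex.I • matB a gp gm)

/-- The matrix `conj 𝒜 + i conj ℬ + conj U (𝒜 + i ℬ)`. -/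
def matPlus (a : ℝ) (gp gm : ℝ → ℂ) (U : Matrix (Fin 2) (Fin 2) ℂ) :
    Matrix (Fin 2) (Fin 2) ℂ :=
  conjMatrix (matA a gp gm) + Complex.I • conjMatrix (matB a gp gm) +
    conjMatrix U * (matA a gp gm + Complex.I • matB a gp gm)

/-- The boundary matrix `𝒰` associated with `U`. -/
def boundaryMatrix (a : ℝ) (gp gm : ℝ → ℂ) (U : Matrix (Fin 2) (Fin 2) ℂ) :
    Matrix (Fin 2) (Fin 2) ℂ :=
  (-(1 / 2) : ℂ) • (!![1, 1; -1, 1] * (matMinus a gp gm U)⁻¹ * matPlus a gp gm U *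
    !![1, -1; 1, 1])

/-- The boundary conditions
`(f'(a) - i f(a), f'(-a) + i f(-a))ᵀ = W (f'(a) + i f(a), f'(-a) - i f(-a))ᵀ`. -/
def SatisfiesBC (a : ℝ) (W : Matrix (Fin 2) (Fin 2) ℂ) (f : ℝ → ℂ) : Prop :=
  ![d1 a f a - Complex.I * f a, d1 a f (-a) + Complex.I * f (-a)] =
    W *ᵥ ![d1 a f a + Complex.I * f a, d1 a f (-a) - Complex.I * f (-a)]

/-- The functions in `AC²[-a, a]` satisfying the boundary conditions with matrix `W`, as elements of
`L²[-a, a]`. -/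
def bcDomain (a : ℝ) (W : Matrix (Fin 2) (Fin 2) ℂ) : Set (BoxL2 a) :=
  {u | ∃ f, IsAC2 a f ∧ u =ᵐ[boxMeasure a] f ∧ SatisfiesBC a W f}

/-- The linear map `Ker (T† - i) → Ker (T† + i)` with matrix `U = (u_{jk})` in the sense
`bp j ↦ ∑ k, u_{jk} bm k`. -/
def deficiencyMap {H : Type*} [NormedAddCommGroup H] [InnerProductSpace ℂ H] [CompleteSpace H]
    {T : H →ₗ.[ℂ] H} (bp : OrthonormalBasis (Fin 2) ℂ (deficiencySpace T Complex.I))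
    (bm : OrthonormalBasis (Fin 2) ℂ (deficiencySpace T (-Complex.I)))
    (U : Matrix (Fin 2) (Fin 2) ℂ) :
    deficiencySpace T Complex.I →ₗ[ℂ] deficiencySpace T (-Complex.I) :=
  bp.toBasis.constr ℂ fun j => ∑ k, U j k • bm k

end BoxSchrodinger

end

/-!
# Self-adjoint extensions of the Schrödinger operator on an interval

Everything is read off from the boundary values of functions in `AC²[-a, a]`.

*The adjoint.* If `u` lies in the domain of `A†`, then `u'' = k` holds weakly for some `k ∈ L²`,
tested against the minimal domain. Second derivatives of minimal functions are exactly the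
functions orthogonal to `1` and `x`, so `u` differs from a second primitive of `k` by an affine
function (`exists_isAC2_of_weak`). Hence the domain of `A†` is `AC²[-a, a]`. By Green's formula,
the boundary form `⟪A† f, h⟫ - ⟪f, A† h⟫` is a multiple of `⟪x(f), x(h)⟫ - ⟪y(f), y(h)⟫`, where
`x(f) = (f'(a) - i f(a), f'(-a) + i f(-a))` and `y(f) = (f'(a) + i f(a), f'(-a) - i f(-a))`. These
two boundary vectors can be prescribed independently, and they vanish simultaneously only on the
domain of `A`. In other words they form a boundary triple (`isBoundaryTriple_minimalOp`).

*Self-adjoint extensions.* For a boundary triple, the self-adjoint extensions are the restrictions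
of the adjoint to Lagrangian subspaces for the boundary form, and these are the subspaces
`x = W y` with `W` unitary (`IsBoundaryTriple.isSelfAdjoint_of_domain`,
`IsBoundaryTriple.exists_unitary_of_isSelfAdjoint`).

*Deficiency solutions.* No theory of differential equations with discontinuous coefficients is
needed. The extension `B` with `x = y`, which is the Dirichlet operator, is self-adjoint, so `B - i`
is onto. Therefore the kernel of `A† - i` contains exactly one function with given values at `±a`
(`IsBoundaryTriple.exists_deficiency`, `IsBoundaryTriple.eq_zero_of_deficiency`). By uniqueness the
solutions with equal or opposite values at `±a` are even or odd. They span the deficiency space,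
whose dimension is at most two.

*The matrix.* Green's formula for a normalized deficiency solution `g` of definite parity gives
`conj g g' - conj g' g = -i` at `a`. With the diagonal matrices `E = conj 𝒜 - i conj ℬ` and
`F = 𝒜 - i ℬ` this says `E Eᴴ = F Fᴴ + 2`, and the matrices in the theorem are `E + X F` and
`Fᴴ + X Eᴴ` with `X = conj U`. The polynomial identities `IsHyperbolicPair.gram_identity`,
`IsHyperbolicPair.left_identity` and `IsHyperbolicPair.right_identity` show that the linear
fractional map `X ↦ (E + X F)⁻¹ (Fᴴ + X Eᴴ)` detects unitarity and permutes the unitary group.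

*Conclusion.* The boundary vectors of `g_j + ∑ k, u_{jk} conj g_k` are, up to a fixed invertible
matrix and scalars, the columns of the conjugate transposes of those two matrices
(`parityMatrix_mul_outMatrix_inMatrix`). So these functions satisfy the boundary condition with
matrix `boundaryMatrix a gp gm U`, and they span its solutions modulo the domain of `A`, because
their vectors `y` are linearly independent (`mem_vonNeumannDomain_iff`).
-/

open MeasureTheory Set
open scoped ENNReal LinearPMap Matrix

namespace BoxSchrodinger

/-! ### Absolutely continuous complex-valued functions -/

section AbsolutelyContinuous

theorem _root_.AbsolutelyContinuousOnInterval.congr {E : Type*} [PseudoMetricSpace E]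
    {f g : ℝ → E} {c d : ℝ} (hg : AbsolutelyContinuousOnInterval g c d)
    (h : EqOn f g (uIcc c d)) : AbsolutelyContinuousOnInterval f c d := by
  rw [absolutelyContinuousOnInterval_iff] at hg ⊢
  intro ε hε
  obtain ⟨δ, hδ, H⟩ := hg ε hε
  refine ⟨δ, hδ, fun E hE hs => ?_⟩
  convert! H E hE hs using 1
  refine Finset.sum_congr rfl fun i hi => ?_
  have := hE.1 i hi
  rw [h this.1, h this.2]

theorem _root_.AbsolutelyContinuousOnInterval.clm_comp {E F : Type*} [NormedAddCommGroup E]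
    [NormedSpace ℝ E] [NormedAddCommGroup F] [NormedSpace ℝ F] (L : E →L[ℝ] F) {f : ℝ → E}
    {c d : ℝ} (hf : AbsolutelyContinuousOnInterval f c d) :
    AbsolutelyContinuousOnInterval (fun x => L (f x)) c d := by
  apply squeeze_zero (fun t => ?_) (fun t => ?_) (by
    simpa only [mul_zero] using Filter.Tendsto.const_mul ‖L‖ hf)
  · exact Finset.sum_nonneg fun i _ => dist_nonneg
  · rw [Finset.mul_sum]
    refine Finset.sum_le_sum fun i _ => ?_
    rw [dist_eq_norm, dist_eq_norm, ← map_sub]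
    exact L.le_opNorm _

/-- Indefinite integrals of complex-valued functions are absolutely continuous, by the real-valued
case applied to real and imaginary parts. -/
theorem absolutelyContinuous_integral {k : ℝ → ℂ} {c d : ℝ}
    (hk : IntervalIntegrable k volume c d) :
    AbsolutelyContinuousOnInterval (fun x => ∫ t in c..x, k t) c d := by
  have hre : IntervalIntegrable (fun t => (k t).re) volume c d :=
    ⟨hk.1.re, hk.2.re⟩
  have him : IntervalIntegrable (fun t => (k t).im) volume c d :=
    ⟨hk.1.im, hk.2.im⟩
  have h1 := (hre.absolutelyContinuousOnInterval_intervalIntegral (c := c) (by simp)).clm_comp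
    Complex.ofRealCLM
  have h2 := ((him.absolutelyContinuousOnInterval_intervalIntegral (c := c) (by simp)).clm_comp
    Complex.ofRealCLM).const_smul Complex.I
  refine (h1.add h2).congr fun x hx => ?_
  have hi : IntervalIntegrable k volume c x := hk.mono_set (uIcc_subset_uIcc_left hx)
  apply Complex.ext
  · have := Complex.reCLM.intervalIntegral_comp_comm hi
    simpa using this.symm
  · have := Complex.imCLM.intervalIntegral_comp_comm hi
    simpa using this.symm

/-- The fundamental theorem of calculus for an absolutely continuous complex-valued function. -/
theorem integral_eq_sub_of_absolutelyContinuous {f k : ℝ → ℂ} {c d : ℝ}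
    (hf : AbsolutelyContinuousOnInterval f c d) (hk : IntervalIntegrable k volume c d)
    (h : ∀ᵐ x, x ∈ uIcc c d → HasDerivAt f (k x) x) :
    ∫ x in c..d, k x = f d - f c := by
  -- the difference of `f` and the indefinite integral of `k` has derivative zero almost everywhere
  have hg : AbsolutelyContinuousOnInterval (f - fun x => ∫ t in c..x, k t) c d :=
    hf.sub (absolutelyContinuous_integral hk)
  have h0 : ∀ᵐ x, x ∈ uIcc c d → HasDerivAt (f - fun x => ∫ t in c..x, k t) 0 x := by
    filter_upwards [h, hk.ae_hasDerivAt_integral] with x hx1 hx2 hx3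
    convert! (hx1 hx3).sub (hx2 hx3 c (by simp)) using 1
    simp
  obtain ⟨C, hC⟩ := hg.const_of_ae_hasDerivAt_zero h0
  have h1 := hC c (by simp)
  have h2 := hC d (by simp)
  simp only [Pi.sub_apply, intervalIntegral.integral_same, sub_zero] at h1 h2
  rw [h1, ← h2]
  ring

end AbsolutelyContinuous

/-! ### The space `AC²[-a, a]` -/

section AC2

variable {a : ℝ} {V : ℝ → ℝ} {f g k : ℝ → ℂ}

theorem left_mem (ha : 0 < a) : -a ∈ Icc (-a) a := left_mem_Icc.mpr (by linarith)

theorem right_mem (ha : 0 < a) : a ∈ Icc (-a) a := right_mem_Icc.mpr (by linarith)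

theorem uIcc_box (ha : 0 < a) : uIcc (-a) a = Icc (-a) a := uIcc_of_le (by linarith)

theorem uniqueDiffOn_box (ha : 0 < a) : UniqueDiffOn ℝ (Icc (-a) a) :=
  uniqueDiffOn_Icc (by linarith)

theorem IsAC2.continuousOn (hf : IsAC2 a f) : ContinuousOn f (Icc (-a) a) :=
  hf.differentiableOn.continuousOn

theorem memLp_of_continuousOn (hf : ContinuousOn f (Icc (-a) a)) (p : ℝ≥0∞) :
    MemLp f p (boxMeasure a) := by
  obtain ⟨C, hC⟩ := isCompact_Icc.exists_bound_of_continuousOn hf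
  exact MemLp.of_bound (hf.aestronglyMeasurable measurableSet_Icc) C
    ((ae_restrict_iff' measurableSet_Icc).mpr (Filter.Eventually.of_forall hC))

theorem intervalIntegrable_of_memLp (ha : 0 < a) (hk : MemLp k 2 (boxMeasure a)) :
    IntervalIntegrable k volume (-a) a := by
  rw [intervalIntegrable_iff_integrableOn_Icc_of_le (by linarith)]
  exact hk.integrable (by norm_num)

theorem integral_box (ha : 0 < a) (k : ℝ → ℂ) :
    ∫ x, k x ∂boxMeasure a = ∫ x in (-a)..a, k x := by
  rw [intervalIntegral.integral_of_le (by linarith), integral_Icc_eq_integral_Ioc]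

/-- A property holding almost everywhere in the interior holds almost everywhere on `[-a, a]`. -/
theorem ae_box_of_ae_Ioo {p : ℝ → Prop} (h : ∀ᵐ x, x ∈ Ioo (-a) a → p x) :
    ∀ᵐ x, x ∈ Icc (-a) a → p x := by
  have h1 : ∀ᵐ x : ℝ, x ≠ a := by simp [ae_iff]
  have h2 : ∀ᵐ x : ℝ, x ≠ -a := by simp [ae_iff]
  filter_upwards [h, h1, h2] with x hx n1 n2 hm
  exact hx ⟨lt_of_le_of_ne hm.1 n2.symm, lt_of_le_of_ne hm.2 n1⟩

theorem IsAC2.hasDerivAt (hf : IsAC2 a f) {x : ℝ} (hx : x ∈ Ioo (-a) a) :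
    HasDerivAt f (d1 a f x) x :=
  (hf.differentiableOn x (Ioo_subset_Icc_self hx)).hasDerivWithinAt.hasDerivAt
    (Icc_mem_nhds hx.1 hx.2)

theorem IsAC2.ae_hasDerivAt_d1 (ha : 0 < a) (hf : IsAC2 a f) :
    ∀ᵐ x, x ∈ Icc (-a) a → HasDerivAt (d1 a f) (d2 a f x) x := by
  apply ae_box_of_ae_Ioo
  filter_upwards [hf.absolutelyContinuous.boundedVariationOn.ae_differentiableAt_of_mem_uIcc]
    with x hx hxI
  have h := hx (by rw [uIcc_box ha]; exact Ioo_subset_Icc_self hxI)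
  have e : d2 a f x = deriv (d1 a f) x :=
    h.derivWithin (uniqueDiffOn_box ha x (Ioo_subset_Icc_self hxI))
  rw [e]
  exact h.hasDerivAt

/-- Functions in `AC²` are themselves absolutely continuous, being integrals of `f'`. -/
theorem IsAC2.absolutelyContinuous_self (ha : 0 < a) (hf : IsAC2 a f) :
    AbsolutelyContinuousOnInterval f (-a) a := by
  have hi : IntervalIntegrable (d1 a f) volume (-a) a :=
    (hf.absolutelyContinuous.continuousOn).intervalIntegrable
  have h := ((contDiff_const (c := f (-a))).contDiffOn.absolutelyContinuousOnInterval
    (a := -a) (b := a)).add (absolutelyContinuous_integral hi)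
  refine h.congr fun x hx => ?_
  rw [uIcc_box ha] at hx
  have hsub : Icc (-a) x ⊆ Icc (-a) a := Icc_subset_Icc_right hx.2
  have := intervalIntegral.integral_eq_sub_of_hasDerivAt_of_le hx.1
    (hf.continuousOn.mono hsub)
    (fun y hy => hf.hasDerivAt ⟨hy.1, hy.2.trans_le hx.2⟩)
    (hi.mono_set (by rw [uIcc_of_le hx.1, uIcc_box ha]; exact hsub))
  simp [this]

/-- A criterion for membership in `AC²` which also identifies the first two derivatives. -/
theorem isAC2_of_hasDeriv (ha : 0 < a)
    (h1 : ∀ x ∈ Icc (-a) a, HasDerivWithinAt f (g x) (Icc (-a) a) x)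
    (hg : AbsolutelyContinuousOnInterval g (-a) a) (hk : MemLp k 2 (boxMeasure a))
    (h2 : ∀ᵐ x, x ∈ Icc (-a) a → HasDerivAt g (k x) x) :
    IsAC2 a f ∧ EqOn (d1 a f) g (Icc (-a) a) ∧ d2 a f =ᵐ[boxMeasure a] k := by
  have e1 : EqOn (d1 a f) g (Icc (-a) a) := fun x hx =>
    (h1 x hx).derivWithin (uniqueDiffOn_box ha x hx)
  have e2 : d2 a f =ᵐ[boxMeasure a] k := by
    refine (ae_restrict_iff' measurableSet_Icc).mpr ?_
    filter_upwards [h2] with x hx hxI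
    exact (derivWithin_congr e1 (e1 hxI)).trans
      ((hx hxI).hasDerivWithinAt.derivWithin (uniqueDiffOn_box ha x hxI))
  exact ⟨⟨fun x hx => (h1 x hx).differentiableWithinAt, hg.congr (by rwa [uIcc_box ha]),
    (memLp_congr_ae e2).mpr hk⟩, e1, e2⟩

/-- Every square-integrable function is the second derivative of a function in `AC²` with
vanishing data at `-a`. -/
theorem exists_isAC2_d2_eq (ha : 0 < a) (hk : MemLp k 2 (boxMeasure a)) :
    ∃ F, IsAC2 a F ∧ F (-a) = 0 ∧ d1 a F (-a) = 0 ∧ d2 a F =ᵐ[boxMeasure a] k := by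
  have hi : Integrable ((Icc (-a) a).indicator k) volume :=
    (integrable_indicator_iff measurableSet_Icc).mpr (hk.integrable (by norm_num))
  -- extending `k` by zero makes its primitive continuous on the whole line
  set K := (Icc (-a) a).indicator k with hK
  have hc : Continuous fun x => ∫ t in (-a)..x, K t :=
    intervalIntegral.continuous_primitive (fun _ _ => hi.intervalIntegrable) _
  have hKk : K =ᵐ[boxMeasure a] k := indicator_ae_eq_restrict measurableSet_Icc
  obtain ⟨h1, h2, h3⟩ := isAC2_of_hasDeriv (k := K) (g := fun x => ∫ t in (-a)..x, K t)
    (f := fun x => ∫ s in (-a)..x, ∫ t in (-a)..s, K t) ha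
    (fun x _ => (hc.integral_hasStrictDerivAt (-a) x).hasDerivAt.hasDerivWithinAt)
    (absolutelyContinuous_integral hi.intervalIntegrable)
    ((memLp_congr_ae hKk).mpr hk)
    (by
      filter_upwards [(hi.intervalIntegrable (a := -a) (b := a)).ae_hasDerivAt_integral]
        with x hx hxI
      rw [uIcc_box ha] at hx
      exact hx hxI (-a) (left_mem ha))
  refine ⟨_, h1, by simp, ?_, h3.trans hKk⟩
  rw [h2 (left_mem ha)]
  simp

theorem isAC2_conj (ha : 0 < a) (hf : IsAC2 a f) :
    IsAC2 a (fun x => (starRingEnd ℂ) (f x)) ∧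
      EqOn (d1 a fun x => (starRingEnd ℂ) (f x)) (fun x => (starRingEnd ℂ) (d1 a f x))
        (Icc (-a) a) ∧
      d2 a (fun x => (starRingEnd ℂ) (f x)) =ᵐ[boxMeasure a]
        fun x => (starRingEnd ℂ) (d2 a f x) := by
  refine isAC2_of_hasDeriv ha (fun x hx => ?_)
    (hf.absolutelyContinuous.clm_comp (Complex.conjCLE : ℂ →L[ℝ] ℂ)) hf.memLp.star ?_
  · exact (Complex.conjCLE : ℂ →L[ℝ] ℂ).hasFDerivAt.comp_hasDerivWithinAt x
      (hf.differentiableOn x hx).hasDerivWithinAt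
  · filter_upwards [hf.ae_hasDerivAt_d1 ha] with x hx hxI
    exact (Complex.conjCLE : ℂ →L[ℝ] ℂ).hasFDerivAt.comp_hasDerivAt x (hx hxI)

theorem neg_mem_box {x : ℝ} : -x ∈ Icc (-a) a ↔ x ∈ Icc (-a) a := by
  constructor <;> rintro ⟨h1, h2⟩ <;> constructor <;> linarith

theorem measurePreserving_neg_box (a : ℝ) :
    MeasurePreserving (fun x : ℝ => -x) (boxMeasure a) (boxMeasure a) := by
  have h := (Measure.measurePreserving_neg (volume : Measure ℝ)).restrict_preimage
    (measurableSet_Icc (a := -a) (b := a))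
  rwa [show (Neg.neg ⁻¹' Icc (-a) a : Set ℝ) = Icc (-a) a by ext x; exact neg_mem_box] at h

/-- The reflection of `f'` is written as an integral, since the definition of absolute continuity by
half-open intervals is not visibly invariant under reflection. -/
theorem IsAC2.absolutelyContinuous_d1_comp_neg (ha : 0 < a) (hf : IsAC2 a f) :
    AbsolutelyContinuousOnInterval (fun x => d1 a f (-x)) (-a) a := by
  have hm : MemLp (fun x => -d2 a f (-x)) 2 (boxMeasure a) :=
    (hf.memLp.comp_measurePreserving (measurePreserving_neg_box a)).neg
  have hi := intervalIntegrable_of_memLp ha hf.memLp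
  have h := ((contDiff_const (c := d1 a f a)).contDiffOn.absolutelyContinuousOnInterval
    (a := -a) (b := a)).add
      (absolutelyContinuous_integral (intervalIntegrable_of_memLp ha hm))
  refine h.congr fun x hx => ?_
  rw [uIcc_box ha] at hx
  have hx' := neg_mem_box.mpr hx
  have hsub : uIcc (-x) a ⊆ uIcc (-a) a := by
    rw [uIcc_of_le (by linarith [hx.1]), uIcc_box ha]
    exact Icc_subset_Icc_left hx'.1
  have h1 := integral_eq_sub_of_absolutelyContinuous (hf.absolutelyContinuous.mono hsub)
    (hi.mono_set hsub) (by
      filter_upwards [hf.ae_hasDerivAt_d1 ha] with y hy hyI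
      exact hy (by rw [← uIcc_box ha]; exact hsub hyI))
  have h2 : ∫ t in (-a)..x, d2 a f (-t) = ∫ t in (-x)..a, d2 a f t := by simp
  simp [intervalIntegral.integral_neg, h1]

theorem isAC2_comp_neg (ha : 0 < a) (hf : IsAC2 a f) :
    IsAC2 a (fun x => f (-x)) ∧
      EqOn (d1 a fun x => f (-x)) (fun x => -d1 a f (-x)) (Icc (-a) a) ∧
      d2 a (fun x => f (-x)) =ᵐ[boxMeasure a] fun x => d2 a f (-x) := by
  refine isAC2_of_hasDeriv ha (fun x hx => ?_)
    (hf.absolutelyContinuous_d1_comp_neg ha).fun_neg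
    (hf.memLp.comp_measurePreserving (measurePreserving_neg_box a)) ?_
  · have h := (hf.differentiableOn (-x) (neg_mem_box.mpr hx)).hasDerivWithinAt.scomp x
      (hasDerivWithinAt_neg x (Icc (-a) a)) (fun y hy => neg_mem_box.mpr hy)
    simpa [Function.comp_def, d1] using h
  · filter_upwards [(Measure.measurePreserving_neg (volume : Measure ℝ)).quasiMeasurePreserving.ae
      (hf.ae_hasDerivAt_d1 ha)] with x hx hxI
    have h := ((hx (neg_mem_box.mpr hxI)).scomp x (hasDerivAt_neg x))
    convert! h.neg using 1
    simp

/-- Green's formula (Lagrange's identity) on `AC²`. -/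
theorem green (ha : 0 < a) (hf : IsAC2 a f) (hg : IsAC2 a g) :
    ∫ x, (starRingEnd ℂ) (f x) * d2 a g x - (starRingEnd ℂ) (d2 a f x) * g x ∂boxMeasure a =
      ((starRingEnd ℂ) (f a) * d1 a g a - (starRingEnd ℂ) (d1 a f a) * g a) -
      ((starRingEnd ℂ) (f (-a)) * d1 a g (-a) - (starRingEnd ℂ) (d1 a f (-a)) * g (-a)) := by
  have cf : AbsolutelyContinuousOnInterval (fun x => (starRingEnd ℂ) (f x)) (-a) a :=
    (hf.absolutelyContinuous_self ha).clm_comp (Complex.conjCLE : ℂ →L[ℝ] ℂ)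
  have cf' : AbsolutelyContinuousOnInterval (fun x => (starRingEnd ℂ) (d1 a f x)) (-a) a :=
    hf.absolutelyContinuous.clm_comp (Complex.conjCLE : ℂ →L[ℝ] ℂ)
  have hac := (cf.fun_smul hg.absolutelyContinuous).fun_sub
    (cf'.fun_smul (hg.absolutelyContinuous_self ha))
  simp only [smul_eq_mul] at hac
  have hb : ∀ {u : ℝ → ℂ}, ContinuousOn u (Icc (-a) a) → MemLp u 2 (boxMeasure a) :=
    fun hu => memLp_of_continuousOn hu 2
  have hcc : ContinuousOn (fun x => (starRingEnd ℂ) (f x)) (Icc (-a) a) := by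
    rw [← uIcc_box ha]; exact cf.continuousOn
  have hint : Integrable (fun x => (starRingEnd ℂ) (f x) * d2 a g x -
      (starRingEnd ℂ) (d2 a f x) * g x) (boxMeasure a) :=
    ((hb hcc).integrable_mul hg.memLp).sub
      (hf.memLp.star.integrable_mul (hb hg.continuousOn))
  rw [integral_box ha]
  refine integral_eq_sub_of_absolutelyContinuous hac ?_ ?_
  · rw [intervalIntegrable_iff_integrableOn_Icc_of_le (by linarith)]
    exact hint
  · rw [uIcc_box ha]
    apply ae_box_of_ae_Ioo
    filter_upwards [hf.ae_hasDerivAt_d1 ha, hg.ae_hasDerivAt_d1 ha] with x hx1 hx2 hxI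
    have hxJ := Ioo_subset_Icc_self hxI
    have e1 : HasDerivAt (fun x => (starRingEnd ℂ) (f x)) ((starRingEnd ℂ) (d1 a f x)) x :=
      (Complex.conjCLE : ℂ →L[ℝ] ℂ).hasFDerivAt.comp_hasDerivAt x (hf.hasDerivAt hxI)
    have e2 : HasDerivAt (fun x => (starRingEnd ℂ) (d1 a f x)) ((starRingEnd ℂ) (d2 a f x)) x :=
      (Complex.conjCLE : ℂ →L[ℝ] ℂ).hasFDerivAt.comp_hasDerivAt x (hx1 hxJ)
    convert! (e1.mul (hx2 hxJ)).sub (e2.mul (hg.hasDerivAt hxI)) using 1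
    ring

end AC2

/-! ### Polynomials and boundary data -/

section BoundaryData

variable {a : ℝ}

theorem isAC2_cubic (ha : 0 < a) (c₀ c₁ c₂ c₃ : ℂ) :
    IsAC2 a (fun x : ℝ => c₀ + c₁ * x + c₂ * x ^ 2 + c₃ * x ^ 3) ∧
    EqOn (d1 a fun x : ℝ => c₀ + c₁ * x + c₂ * x ^ 2 + c₃ * x ^ 3)
      (fun x : ℝ => c₁ + 2 * c₂ * x + 3 * c₃ * x ^ 2) (Icc (-a) a) ∧
    d2 a (fun x : ℝ => c₀ + c₁ * x + c₂ * x ^ 2 + c₃ * x ^ 3) =ᵐ[boxMeasure a]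
      fun x : ℝ => 2 * c₂ + 6 * c₃ * x := by
  have hx : ∀ x : ℝ, HasDerivAt (fun x : ℝ => (x : ℂ)) 1 x := fun x =>
    Complex.ofRealCLM.hasDerivAt
  have hcd : ContDiff ℝ 1 fun x : ℝ => c₁ + 2 * c₂ * (x : ℂ) + 3 * c₃ * (x : ℂ) ^ 2 := by
    have : ContDiff ℝ 1 fun x : ℝ => (x : ℂ) := Complex.ofRealCLM.contDiff
    fun_prop
  refine isAC2_of_hasDeriv ha (fun x _ => HasDerivAt.hasDerivWithinAt ?_)
    hcd.contDiffOn.absolutelyContinuousOnInterval (memLp_of_continuousOn (by fun_prop) 2)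
    (Filter.Eventually.of_forall fun x _ => ?_)
  · convert! ((((hx x).const_mul c₁).const_add c₀).add (((hx x).pow 2).const_mul c₂)).add
      (((hx x).pow 3).const_mul c₃) using 1
    push_cast
    ring
  · convert! (((hx x).const_mul (2 * c₂)).const_add c₁).add (((hx x).pow 2).const_mul (3 * c₃))
      using 1
    push_cast
    ring

/-- The boundary data `f(±a)`, `f'(±a)` of functions in `AC²` can be prescribed freely (by cubic
Hermite interpolation). -/
theorem exists_isAC2_boundary (ha : 0 < a) (p q r s : ℂ) :
    ∃ f, IsAC2 a f ∧ f a = p ∧ f (-a) = q ∧ d1 a f a = r ∧ d1 a f (-a) = s := by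
  have ha' : (a : ℂ) ≠ 0 := by exact_mod_cast ha.ne'
  obtain ⟨h, h1, -⟩ := isAC2_cubic ha ((p + q) / 2 - a * (r - s) / 4)
    ((p - q) / (2 * a) - ((r + s) / (4 * a ^ 2) - (p - q) / (4 * a ^ 3)) * a ^ 2)
    ((r - s) / (4 * a)) ((r + s) / (4 * a ^ 2) - (p - q) / (4 * a ^ 3))
  refine ⟨_, h, ?_, ?_, (h1 (right_mem ha)).trans ?_, (h1 (left_mem ha)).trans ?_⟩
  all_goals
    push_cast
    field_simp
    ring

theorem isAC2_affine (ha : 0 < a) (c d : ℂ) :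
    IsAC2 a (fun x : ℝ => c + d * x) ∧
    EqOn (d1 a fun x : ℝ => c + d * x) (fun _ => d) (Icc (-a) a) ∧
    d2 a (fun x : ℝ => c + d * x) =ᵐ[boxMeasure a] fun _ => 0 := by
  simpa using isAC2_cubic ha c d 0 0

end BoundaryData

/-! ### Weak second derivatives -/

section Weak

variable {a : ℝ} {f g k : ℝ → ℂ}

/-- A square-integrable function orthogonal to `1` and `x` is the second derivative of a function
in the minimal domain. -/
theorem exists_isMinimal_d2_eq (ha : 0 < a) (hk : MemLp k 2 (boxMeasure a))
    (h0 : ∫ x, k x ∂boxMeasure a = 0) (h1 : ∫ x, (x : ℂ) * k x ∂boxMeasure a = 0) :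
    ∃ φ, IsMinimal a φ ∧ d2 a φ =ᵐ[boxMeasure a] k := by
  obtain ⟨φ, hφ, hl, hl', h2⟩ := exists_isAC2_d2_eq ha hk
  -- Green's formula for `φ` and an affine function
  have key : ∀ c d : ℂ, (starRingEnd ℂ) (c + d * a) * d1 a φ a - (starRingEnd ℂ) d * φ a =
      ∫ x : ℝ, (starRingEnd ℂ) (c + d * x) * k x ∂boxMeasure a := by
    intro c d
    obtain ⟨e, e1, e2⟩ := isAC2_affine ha c d
    have h := green ha e hφ
    rw [e1 (right_mem ha), e1 (left_mem ha), hl, hl'] at h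
    simp only [mul_zero, sub_zero] at h
    rw [← h]
    refine integral_congr_ae ?_
    filter_upwards [h2, e2] with x hx1 hx2
    simp [hx1, hx2]
  have d1a : d1 a φ a = 0 := by
    have := key 1 0
    simpa [h0] using this
  have d0a : φ a = 0 := by
    have := key 0 1
    simpa [h1, d1a] using this
  exact ⟨φ, ⟨hφ, d0a, hl, d1a, hl'⟩, h2⟩

theorem integrable_conj_mul (hf : MemLp f 2 (boxMeasure a)) (hg : MemLp g 2 (boxMeasure a)) :
    Integrable (fun x => (starRingEnd ℂ) (f x) * g x) (boxMeasure a) :=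
  hf.star.integrable_mul hg

theorem inner_box {u v : BoxL2 a} (hu : u =ᵐ[boxMeasure a] f) (hv : v =ᵐ[boxMeasure a] g) :
    inner ℂ u v = ∫ x, (starRingEnd ℂ) (f x) * g x ∂boxMeasure a := by
  rw [L2.inner_def]
  refine integral_congr_ae ?_
  filter_upwards [hu, hv] with x h1 h2
  rw [RCLike.inner_apply, h1, h2, mul_comm]

/-- **Weak regularity.** If `u'' = k` holds weakly, tested against the minimal domain, then `u` is
(almost everywhere equal to) a function in `AC²` and `u'' = k` almost everywhere: the difference of
`u` and a second primitive of `k` is orthogonal to `{1, x}ᗮ`, hence affine. -/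
theorem exists_isAC2_of_weak (ha : 0 < a) (u k : BoxL2 a)
    (h : ∀ φ, IsMinimal a φ → ∫ x, (starRingEnd ℂ) (d2 a φ x) * u x ∂boxMeasure a =
      ∫ x, (starRingEnd ℂ) (φ x) * k x ∂boxMeasure a) :
    ∃ F, IsAC2 a F ∧ u =ᵐ[boxMeasure a] F ∧ d2 a F =ᵐ[boxMeasure a] k := by
  obtain ⟨F, hF, -, -, hFk⟩ := exists_isAC2_d2_eq ha (Lp.memLp k)
  have mF := memLp_of_continuousOn hF.continuousOn 2
  have m0 : MemLp (fun _ : ℝ => (1 : ℂ)) 2 (boxMeasure a) :=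
    memLp_of_continuousOn (by fun_prop) 2
  have m1 : MemLp (fun x : ℝ => (x : ℂ)) 2 (boxMeasure a) :=
    memLp_of_continuousOn (by fun_prop) 2
  have : FiniteDimensional ℂ (Submodule.span ℂ {m0.toLp, m1.toLp}) :=
    FiniteDimensional.span_of_finite ℂ (Set.toFinite _)
  have hv : u - mF.toLp F ∈ Submodule.span ℂ {m0.toLp, m1.toLp} := by
    rw [← Submodule.orthogonal_orthogonal (Submodule.span ℂ {m0.toLp, m1.toLp}),
      Submodule.mem_orthogonal]
    intro ψ hψ
    rw [Submodule.mem_orthogonal] at hψ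
    have o0 := hψ m0.toLp (Submodule.subset_span (by simp))
    have o1 := hψ m1.toLp (Submodule.subset_span (by simp))
    rw [inner_box m0.coeFn_toLp (Filter.EventuallyEq.refl _ ψ)] at o0
    rw [inner_box m1.coeFn_toLp (Filter.EventuallyEq.refl _ ψ)] at o1
    obtain ⟨φ, hφ, hφψ⟩ := exists_isMinimal_d2_eq ha (Lp.memLp ψ) (by simpa using o0)
      (by simpa using o1)
    have hg := green ha hφ.toIsAC2 hF
    simp only [hφ.right, hφ.left, hφ.d1_right, hφ.d1_left, map_zero, zero_mul, sub_zero] at hg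
    rw [integral_sub (integrable_conj_mul (memLp_of_continuousOn hφ.continuousOn 2) hF.memLp)
      (integrable_conj_mul hφ.memLp mF), sub_eq_zero] at hg
    rw [inner_sub_right, inner_box hφψ.symm (Filter.EventuallyEq.refl _ u),
      inner_box hφψ.symm mF.coeFn_toLp, h φ hφ, ← hg, sub_eq_zero]
    refine integral_congr_ae ?_
    filter_upwards [hFk] with x hx
    rw [hx]
  obtain ⟨c, d, hcd⟩ := Submodule.mem_span_pair.mp hv
  obtain ⟨e, -, e2⟩ := isAC2_affine ha c d
  refine ⟨F + fun x : ℝ => c + d * x, hF.add ha e, ?_, ?_⟩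
  · have hu : u = mF.toLp F + (c • m0.toLp + d • m1.toLp) := by rw [hcd]; abel
    have h1 := Lp.coeFn_add (mF.toLp F) (c • m0.toLp + d • m1.toLp)
    rw [← hu] at h1
    filter_upwards [h1, Lp.coeFn_add (c • m0.toLp) (d • m1.toLp), Lp.coeFn_smul c m0.toLp,
      Lp.coeFn_smul d m1.toLp, mF.coeFn_toLp, m0.coeFn_toLp, m1.coeFn_toLp]
      with x h1 h2 h3 h4 h5 h6 h7
    rw [h1, Pi.add_apply, h2, Pi.add_apply, h3, h4, Pi.smul_apply, Pi.smul_apply, h5, h6, h7]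
    simp [mul_comm d]
  · filter_upwards [hF.d2_add ha e, hFk, e2] with x h1 h2 h3
    simp [h1, h2, h3]

end Weak

/-! ### The adjoint of the minimal operator -/

section Adjoint

variable {a : ℝ} {V : ℝ → ℝ} {f g : ℝ → ℂ}

theorem d2_congr (h : EqOn f g (Icc (-a) a)) : EqOn (d2 a f) (d2 a g) (Icc (-a) a) := by
  have h1 : EqOn (d1 a f) (d1 a g) (Icc (-a) a) := fun y hy => derivWithin_congr h (h hy)
  exact fun x hx => derivWithin_congr h1 (h1 hx)

theorem ae_box_of_eqOn (h : EqOn f g (Icc (-a) a)) : f =ᵐ[boxMeasure a] g :=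
  (ae_restrict_iff' measurableSet_Icc).mpr (Filter.Eventually.of_forall h)

/-- The class in `L²` of a function in `AC²`. -/
noncomputable def IsAC2.toL2 (hf : IsAC2 a f) : BoxL2 a :=
  (memLp_of_continuousOn hf.continuousOn 2).toLp f

theorem IsAC2.coeFn_toL2 (hf : IsAC2 a f) : hf.toL2 =ᵐ[boxMeasure a] f :=
  MemLp.coeFn_toLp _

/-- The class in `L²` of `-f'' + V f` for `f` in `AC²`. -/
noncomputable def IsAC2.opL2 (hV : IsPotential a V) (hf : IsAC2 a f) : BoxL2 a :=
  (hf.memLp_formalOp hV).toLp (formalOp a V f)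

theorem IsAC2.coeFn_opL2 (hV : IsPotential a V) (hf : IsAC2 a f) :
    hf.opL2 hV =ᵐ[boxMeasure a] formalOp a V f :=
  MemLp.coeFn_toLp _

theorem IsMinimal.toL2_mem (ha : 0 < a) (hV : IsPotential a V) (hf : IsMinimal a f) :
    hf.toL2 ∈ (minimalOp ha hV).domain :=
  ⟨f, hf, hf.coeFn_toL2⟩

theorem IsMinimal.minimalOp_toL2 (ha : 0 < a) (hV : IsPotential a V) (hf : IsMinimal a f) :
    minimalOp ha hV ⟨hf.toL2, hf.toL2_mem ha hV⟩ = hf.opL2 hV :=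
  Lp.ext ((minimalOp_apply ha hV _ hf.toIsAC2 hf.coeFn_toL2).trans (hf.coeFn_opL2 hV).symm)

/-- A vector `u` orthogonal to the minimal domain satisfies `0'' = u` weakly, hence vanishes. -/
theorem dense_minimalOp_domain (ha : 0 < a) (hV : IsPotential a V) :
    Dense ((minimalOp ha hV).domain : Set (BoxL2 a)) := by
  rw [Submodule.dense_iff_topologicalClosure_eq_top, Submodule.topologicalClosure_eq_top_iff,
    Submodule.eq_bot_iff]
  intro u hu
  rw [Submodule.mem_orthogonal] at hu
  obtain ⟨F, hF, h0, hk⟩ := exists_isAC2_of_weak ha 0 u (by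
    intro φ hφ
    have h := hu _ (hφ.toL2_mem ha hV)
    rw [inner_box hφ.coeFn_toL2 (Filter.EventuallyEq.refl _ u)] at h
    rw [h]
    refine integral_eq_zero_of_ae ?_
    filter_upwards [Lp.coeFn_zero ℂ 2 (boxMeasure a)] with x hx
    rw [hx]
    simp)
  have hF0 : EqOn F 0 (Icc (-a) a) :=
    hF.eqOn_of_ae_eq ha isAC2_zero (h0.symm.trans (Lp.coeFn_zero _ _ _))
  have hd : d2 a F =ᵐ[boxMeasure a] 0 := by
    refine ae_box_of_eqOn fun x hx => (d2_congr hF0 hx).trans ?_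
    have h1 : d1 a 0 = 0 := by
      funext x
      exact congrFun (derivWithin_zero (𝕜 := ℝ) (F := ℂ) (s := Icc (-a) a)) x
    rw [d2, h1]
    exact congrFun (derivWithin_zero (𝕜 := ℝ) (F := ℂ) (s := Icc (-a) a)) x
  exact Lp.ext (hk.symm.trans (hd.trans (Lp.coeFn_zero _ _ _).symm))

/-- Green's formula for the differential expression `-f'' + V f`; the potential drops out because
it is real. -/
theorem inner_opL2_sub (ha : 0 < a) (hV : IsPotential a V) (hf : IsAC2 a f) (hg : IsAC2 a g) :
    inner ℂ (hf.opL2 hV) hg.toL2 - inner ℂ hf.toL2 (hg.opL2 hV) =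
      ((starRingEnd ℂ) (f a) * d1 a g a - (starRingEnd ℂ) (d1 a f a) * g a) -
      ((starRingEnd ℂ) (f (-a)) * d1 a g (-a) - (starRingEnd ℂ) (d1 a f (-a)) * g (-a)) := by
  have mf := memLp_of_continuousOn hf.continuousOn 2
  have mg := memLp_of_continuousOn hg.continuousOn 2
  rw [inner_box (hf.coeFn_opL2 hV) hg.coeFn_toL2, inner_box hf.coeFn_toL2 (hg.coeFn_opL2 hV),
    ← green ha hf hg, ← integral_sub (integrable_conj_mul (hf.memLp_formalOp hV) mg)
      (integrable_conj_mul mf (hg.memLp_formalOp hV))]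
  refine integral_congr_ae (Filter.Eventually.of_forall fun x => ?_)
  simp only [formalOp, map_add, map_neg, map_mul, Complex.conj_ofReal]
  ring

theorem inner_minimalOp (ha : 0 < a) (hV : IsPotential a V) (hf : IsAC2 a f)
    (u : (minimalOp ha hV).domain) :
    inner ℂ (hf.opL2 hV) (u : BoxL2 a) = inner ℂ hf.toL2 (minimalOp ha hV u) := by
  obtain ⟨u, φ, hφ, hu⟩ := u
  obtain rfl : u = hφ.toL2 := Lp.ext (hu.trans hφ.coeFn_toL2.symm)
  have h := inner_opL2_sub ha hV hf hφ.toIsAC2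
  simp only [hφ.right, hφ.left, hφ.d1_right, hφ.d1_left, mul_zero, sub_zero] at h
  rw [hφ.minimalOp_toL2 ha hV]
  exact sub_eq_zero.mp h

theorem isFormalAdjoint_minimalOp (ha : 0 < a) (hV : IsPotential a V) :
    (minimalOp ha hV).IsFormalAdjoint (minimalOp ha hV) := by
  rintro ⟨u, φ, hφ, hu⟩ v
  obtain rfl : u = hφ.toL2 := Lp.ext (hu.trans hφ.coeFn_toL2.symm)
  rw [hφ.minimalOp_toL2 ha hV]
  exact inner_minimalOp ha hV hφ.toIsAC2 v

theorem IsAC2.toL2_mem_adjoint (ha : 0 < a) (hV : IsPotential a V) (hf : IsAC2 a f) :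
    hf.toL2 ∈ (minimalOp ha hV)†.domain :=
  LinearPMap.mem_adjoint_domain_of_exists _ ⟨hf.opL2 hV, inner_minimalOp ha hV hf⟩

theorem IsAC2.adjoint_toL2 (ha : 0 < a) (hV : IsPotential a V) (hf : IsAC2 a f) :
    (minimalOp ha hV)† ⟨hf.toL2, hf.toL2_mem_adjoint ha hV⟩ = hf.opL2 hV :=
  LinearPMap.adjoint_apply_eq (dense_minimalOp_domain ha hV) _ (inner_minimalOp ha hV hf)

/-- The domain of the adjoint of the minimal operator consists of functions in `AC²`. -/
theorem exists_isAC2_of_mem_adjoint (ha : 0 < a) (hV : IsPotential a V)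
    (u : (minimalOp ha hV)†.domain) : ∃ f, ∃ hf : IsAC2 a f, (u : BoxL2 a) = hf.toL2 := by
  have mV : MemLp (fun x => (V x : ℂ)) ∞ (boxMeasure a) := hV.bounded.ofReal
  have mVu : MemLp (fun x => (V x : ℂ) * (u : BoxL2 a) x) 2 (boxMeasure a) :=
    (Lp.memLp (u : BoxL2 a)).mul mV
  set w := (minimalOp ha hV)† u with hw
  -- `u'' = V u - A† u` holds weakly
  obtain ⟨F, hF, hu, -⟩ := exists_isAC2_of_weak ha (u : BoxL2 a) (mVu.toLp _ - w) (by
    intro φ hφ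
    have h := LinearPMap.adjoint_isFormalAdjoint (dense_minimalOp_domain ha hV) u
      ⟨hφ.toL2, hφ.toL2_mem ha hV⟩
    rw [hφ.minimalOp_toL2 ha hV] at h
    have h' := congrArg (starRingEnd ℂ) h
    rw [inner_conj_symm, inner_conj_symm, inner_box hφ.coeFn_toL2 (Filter.EventuallyEq.refl _ _),
      inner_box (hφ.coeFn_opL2 hV) (Filter.EventuallyEq.refl _ _)] at h'
    have mφ := memLp_of_continuousOn hφ.continuousOn 2
    have e : ∫ x, (starRingEnd ℂ) (φ x) * (mVu.toLp _ - w : BoxL2 a) x ∂boxMeasure a =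
        ∫ x, (starRingEnd ℂ) (φ x) * ((V x : ℂ) * (u : BoxL2 a) x) ∂boxMeasure a -
          ∫ x, (starRingEnd ℂ) (φ x) * w x ∂boxMeasure a := by
      rw [← integral_sub (integrable_conj_mul mφ mVu) (integrable_conj_mul mφ (Lp.memLp w))]
      refine integral_congr_ae ?_
      filter_upwards [Lp.coeFn_sub (mVu.toLp _) w, mVu.coeFn_toLp] with x h1 h2
      rw [h1, Pi.sub_apply, h2, mul_sub]
    rw [e, h', ← integral_sub (integrable_conj_mul mφ mVu)
      (integrable_conj_mul (hφ.memLp_formalOp hV) (Lp.memLp _))]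
    refine integral_congr_ae (Filter.Eventually.of_forall fun x => ?_)
    simp only [formalOp, map_add, map_neg, map_mul, Complex.conj_ofReal]
    ring)
  exact ⟨F, hF, Lp.ext (hu.trans hF.coeFn_toL2.symm)⟩

theorem IsAC2.toL2_inj (ha : 0 < a) (hf : IsAC2 a f) (hg : IsAC2 a g) (h : hf.toL2 = hg.toL2) :
    EqOn f g (Icc (-a) a) := by
  refine hf.eqOn_of_ae_eq ha hg (hf.coeFn_toL2.symm.trans ?_)
  rw [h]
  exact hg.coeFn_toL2

theorem d1_congr (h : EqOn f g (Icc (-a) a)) : EqOn (d1 a f) (d1 a g) (Icc (-a) a) :=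
  fun _ hy => derivWithin_congr h (h hy)

end Adjoint

/-! ### Boundary values on the domain of the adjoint -/

section Boundary

variable {a : ℝ} {V : ℝ → ℝ} {f g : ℝ → ℂ}

/-- The boundary vector `(f'(a) - i f(a), f'(-a) + i f(-a))`. -/
noncomputable def outVec (a : ℝ) (f : ℝ → ℂ) : Fin 2 → ℂ :=
  ![d1 a f a - Complex.I * f a, d1 a f (-a) + Complex.I * f (-a)]

/-- The boundary vector `(f'(a) + i f(a), f'(-a) - i f(-a))`. -/
noncomputable def inVec (a : ℝ) (f : ℝ → ℂ) : Fin 2 → ℂ :=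
  ![d1 a f a + Complex.I * f a, d1 a f (-a) - Complex.I * f (-a)]

theorem outVec_congr (ha : 0 < a) (h : EqOn f g (Icc (-a) a)) : outVec a f = outVec a g := by
  simp only [outVec, h (left_mem ha), h (right_mem ha), d1_congr h (left_mem ha),
    d1_congr h (right_mem ha)]

theorem inVec_congr (ha : 0 < a) (h : EqOn f g (Icc (-a) a)) : inVec a f = inVec a g := by
  simp only [inVec, h (left_mem ha), h (right_mem ha), d1_congr h (left_mem ha),
    d1_congr h (right_mem ha)]

theorem outVec_add (ha : 0 < a) (hf : IsAC2 a f) (hg : IsAC2 a g) :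
    outVec a (f + g) = outVec a f + outVec a g := by
  ext i
  fin_cases i <;>
  simp [outVec, hf.d1_add hg (left_mem ha), hf.d1_add hg (right_mem ha)] <;> ring

theorem inVec_add (ha : 0 < a) (hf : IsAC2 a f) (hg : IsAC2 a g) :
    inVec a (f + g) = inVec a f + inVec a g := by
  ext i
  fin_cases i <;>
  simp [inVec, hf.d1_add hg (left_mem ha), hf.d1_add hg (right_mem ha)] <;> ring

theorem outVec_smul (ha : 0 < a) (c : ℂ) (hf : IsAC2 a f) : outVec a (c • f) = c • outVec a f := by
  ext i
  fin_cases i <;>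
  simp [outVec, hf.d1_smul c (left_mem ha), hf.d1_smul c (right_mem ha)] <;> ring

theorem inVec_smul (ha : 0 < a) (c : ℂ) (hf : IsAC2 a f) : inVec a (c • f) = c • inVec a f := by
  ext i
  fin_cases i <;>
  simp [inVec, hf.d1_smul c (left_mem ha), hf.d1_smul c (right_mem ha)] <;> ring

theorem IsAC2.toL2_add (ha : 0 < a) (hf : IsAC2 a f) (hg : IsAC2 a g) :
    (hf.add ha hg).toL2 = hf.toL2 + hg.toL2 := rfl

theorem IsAC2.toL2_smul (ha : 0 < a) (c : ℂ) (hf : IsAC2 a f) :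
    (hf.smul ha c).toL2 = c • hf.toL2 := rfl

/-- The linear map on the domain of the adjoint which evaluates a linear, vector-valued function `b`
of functions in `AC²` at the representative in `AC²`. The hypothesis `congr` says that `b` depends
only on the values on `[-a, a]`. -/
noncomputable def evalMap (ha : 0 < a) (hV : IsPotential a V) (b : (ℝ → ℂ) → (Fin 2 → ℂ))
    (congr : ∀ {f g : ℝ → ℂ}, EqOn f g (Icc (-a) a) → b f = b g)
    (add : ∀ {f g : ℝ → ℂ}, IsAC2 a f → IsAC2 a g → b (f + g) = b f + b g)
    (smul : ∀ (c : ℂ) {f : ℝ → ℂ}, IsAC2 a f → b (c • f) = c • b f) :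
    (minimalOp ha hV)†.domain →ₗ[ℂ] (Fin 2 → ℂ) where
  toFun u := b (exists_isAC2_of_mem_adjoint ha hV u).choose
  map_add' u v := by
    obtain ⟨hu, eu⟩ := (exists_isAC2_of_mem_adjoint ha hV u).choose_spec
    obtain ⟨hv, ev⟩ := (exists_isAC2_of_mem_adjoint ha hV v).choose_spec
    obtain ⟨hw, ew⟩ := (exists_isAC2_of_mem_adjoint ha hV (u + v)).choose_spec
    rw [← add hu hv]
    refine congr (hw.toL2_inj ha (hu.add ha hv) ?_)
    rw [← ew, hu.toL2_add ha hv, ← eu, ← ev]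
    rfl
  map_smul' c u := by
    obtain ⟨hu, eu⟩ := (exists_isAC2_of_mem_adjoint ha hV u).choose_spec
    obtain ⟨hw, ew⟩ := (exists_isAC2_of_mem_adjoint ha hV (c • u)).choose_spec
    rw [RingHom.id_apply, ← smul c hu]
    refine congr (hw.toL2_inj ha (hu.smul ha c) ?_)
    rw [← ew, hu.toL2_smul ha c, ← eu]
    rfl

/-- `outVec` as a linear map on the domain of the adjoint. -/
noncomputable def outMap (ha : 0 < a) (hV : IsPotential a V) :
    (minimalOp ha hV)†.domain →ₗ[ℂ] (Fin 2 → ℂ) :=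
  evalMap ha hV (outVec a) (outVec_congr ha) (outVec_add ha) fun c _ => outVec_smul ha c

/-- `inVec` as a linear map on the domain of the adjoint. -/
noncomputable def inMap (ha : 0 < a) (hV : IsPotential a V) :
    (minimalOp ha hV)†.domain →ₗ[ℂ] (Fin 2 → ℂ) :=
  evalMap ha hV (inVec a) (inVec_congr ha) (inVec_add ha) fun c _ => inVec_smul ha c

theorem outMap_eq (ha : 0 < a) (hV : IsPotential a V) (u : (minimalOp ha hV)†.domain)
    (hf : IsAC2 a f) (h : (u : BoxL2 a) = hf.toL2) : outMap ha hV u = outVec a f := by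
  obtain ⟨hu, eu⟩ := (exists_isAC2_of_mem_adjoint ha hV u).choose_spec
  exact outVec_congr ha (hu.toL2_inj ha hf (eu.symm.trans h))

theorem inMap_eq (ha : 0 < a) (hV : IsPotential a V) (u : (minimalOp ha hV)†.domain)
    (hf : IsAC2 a f) (h : (u : BoxL2 a) = hf.toL2) : inMap ha hV u = inVec a f := by
  obtain ⟨hu, eu⟩ := (exists_isAC2_of_mem_adjoint ha hV u).choose_spec
  exact inVec_congr ha (hu.toL2_inj ha hf (eu.symm.trans h))

theorem exists_isAC2_vec (ha : 0 < a) (x y : Fin 2 → ℂ) :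
    ∃ f, IsAC2 a f ∧ outVec a f = x ∧ inVec a f = y := by
  obtain ⟨f, hf, h1, h2, h3, h4⟩ := exists_isAC2_boundary ha ((y 0 - x 0) / (2 * Complex.I))
    ((x 1 - y 1) / (2 * Complex.I)) ((x 0 + y 0) / 2) ((x 1 + y 1) / 2)
  refine ⟨f, hf, ?_, ?_⟩ <;> ext i <;> fin_cases i <;>
    simp [outVec, inVec, h1, h2, h3, h4] <;> field_simp [Complex.I_ne_zero] <;> ring

end Boundary

/-! ### Self-adjoint extensions through boundary values -/

section Algebraic

open scoped ComplexOrder in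
theorem eq_zero_of_star_dotProduct_self {ι : Type*} [Fintype ι] {v : ι → ℂ}
    (hv : star v ⬝ᵥ v = 0) : v = 0 :=
  dotProduct_star_self_eq_zero.mp hv

theorem eq_of_le_of_le {H : Type*} [AddCommGroup H] [Module ℂ H] {T B S : H →ₗ.[ℂ] H}
    (hT : T ≤ S) (hB : B ≤ S) (h : T.domain = B.domain) : T = B := by
  refine LinearPMap.eq_of_le_of_domain_eq ⟨h.le, fun x y hxy => ?_⟩ h
  rw [hT.2 (y := ⟨x, hT.1 x.2⟩) rfl, hB.2 (y := ⟨x, hT.1 x.2⟩) hxy.symm]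

end Algebraic

section Extensions

variable {H : Type*} [NormedAddCommGroup H] [InnerProductSpace ℂ H] [CompleteSpace H]
  {T B : H →ₗ.[ℂ] H}

theorem adjoint_le_adjoint (hd : Dense (T.domain : Set H)) (h : T ≤ B) : B† ≤ T† := by
  have hB : Dense (B.domain : Set H) := hd.mono h.1
  have key : ∀ (y : B†.domain) (x : T.domain), inner ℂ (B† y) (x : H) = inner ℂ (y : H) (T x) := by
    intro y x
    have e : T x = B ⟨x, h.1 x.2⟩ := h.2 rfl
    rw [e]
    exact LinearPMap.adjoint_isFormalAdjoint hB y ⟨x, h.1 x.2⟩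
  refine ⟨fun y hy => LinearPMap.mem_adjoint_domain_of_exists y ⟨B† ⟨y, hy⟩, key ⟨y, hy⟩⟩, ?_⟩
  rintro y z hyz
  refine (LinearPMap.adjoint_apply_eq hd z fun x => ?_).symm
  rw [key y x, hyz]

/-- The domain of the adjoint of an operator `B` between `T` and `T†`, described by the boundary
form of `T†`. -/
theorem mem_adjoint_iff (hd : Dense (T.domain : Set H)) (hTB : T ≤ B) (hB : B ≤ T†)
    (h : T†.domain) : (h : H) ∈ B†.domain ↔ ∀ f : T†.domain, (f : H) ∈ B.domain →
      inner ℂ (T† f) (h : H) = inner ℂ (f : H) (T† h) := by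
  constructor
  · intro hh f hf
    have e1 : B† ⟨h, hh⟩ = T† h := (adjoint_le_adjoint hd hTB).2 rfl
    have e2 : B ⟨f, hf⟩ = T† f := hB.2 rfl
    have := LinearPMap.adjoint_isFormalAdjoint (hd.mono hTB.1) ⟨h, hh⟩ ⟨f, hf⟩
    rw [e1, e2] at this
    have := congrArg (starRingEnd ℂ) this
    rw [inner_conj_symm, inner_conj_symm] at this
    exact this.symm
  · intro hh
    refine LinearPMap.mem_adjoint_domain_of_exists _ ⟨T† h, fun f => ?_⟩
    have e2 : B f = T† ⟨f, hB.1 f.2⟩ := hB.2 rfl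
    have := congrArg (starRingEnd ℂ) (hh ⟨f, hB.1 f.2⟩ f.2)
    rw [inner_conj_symm, inner_conj_symm] at this
    rw [e2, this]

/-- An operator between `T` and `T†` is self-adjoint exactly when its domain is a Lagrangian
subspace for the boundary form of `T†`. -/
theorem isSelfAdjoint_iff_lagrangian (hd : Dense (T.domain : Set H)) (hTB : T ≤ B) (hB : B ≤ T†) :
    IsSelfAdjoint B ↔ ∀ h : T†.domain, (h : H) ∈ B.domain ↔
      ∀ f : T†.domain, (f : H) ∈ B.domain → inner ℂ (T† f) (h : H) = inner ℂ (f : H) (T† h) := by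
  rw [LinearPMap.isSelfAdjoint_def]
  constructor
  · intro e h
    rw [← mem_adjoint_iff hd hTB hB, e]
  · intro hL
    have hle := adjoint_le_adjoint hd hTB
    refine eq_of_le_of_le hle hB (Submodule.ext fun x => ⟨fun hx => ?_, fun hx => ?_⟩)
    · exact (hL ⟨x, hle.1 hx⟩).mpr ((mem_adjoint_iff hd hTB hB ⟨x, hle.1 hx⟩).mp hx)
    · exact (mem_adjoint_iff hd hTB hB ⟨x, hB.1 hx⟩).mpr ((hL ⟨x, hB.1 hx⟩).mp hx)

/-- The operator `B - i` is onto for a self-adjoint operator `B`. Its range is closed, since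
`‖(B - i) f‖² = ‖B f‖² + ‖f‖²` dominates the graph norm, and its orthogonal complement, the kernel
of `B + i`, vanishes by symmetry. -/
theorem exists_apply_sub_eq (hB : IsSelfAdjoint B) (v : H) :
    ∃ f : B.domain, B f - Complex.I • (f : H) = v := by
  have hd := hB.dense_domain
  have hadj := LinearPMap.isSelfAdjoint_def.mp hB
  have hsym : ∀ f h : B.domain, inner ℂ (B f) (h : H) = inner ℂ (f : H) (B h) := by
    intro f h
    have hf : (f : H) ∈ B†.domain := by rw [hadj]; exact f.2
    have := LinearPMap.adjoint_isFormalAdjoint hd ⟨f, hf⟩ h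
    have e : B† ⟨f, hf⟩ = B f := hadj.le.2 rfl
    rwa [e] at this
  -- the map `(f, B f) ↦ B f - i f` on the graph, which is complete
  let L : B.graph →ₗ[ℂ] H :=
    (LinearMap.snd ℂ H H - Complex.I • LinearMap.fst ℂ H H) ∘ₗ B.graph.subtype
  have hLap : ∀ p : B.graph, L p = (p : H × H).2 - Complex.I • (p : H × H).1 := fun p => rfl
  have hnorm : ∀ p : B.graph, ‖p‖ ≤ ‖L p‖ := by
    rintro ⟨p, hp⟩
    obtain ⟨f, rfl⟩ := (LinearPMap.mem_graph_iff' B).mp hp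
    have h1 : RCLike.re (inner ℂ (B f) (Complex.I • (f : H))) = 0 := by
      have h2 := hsym f f
      rw [← inner_conj_symm, Complex.conj_eq_iff_im] at h2
      rw [inner_smul_right]
      have h3 : (inner ℂ (B f) (f : H)).im = 0 := by
        rw [hsym f f, ← inner_conj_symm]
        simp [h2]
      simp [h3]
    have h4 : ‖L ⟨_, hp⟩‖ ^ 2 = ‖B f‖ ^ 2 + ‖(f : H)‖ ^ 2 := by
      rw [hLap, norm_sub_sq (𝕜 := ℂ), h1, norm_smul]
      simp
    change max ‖(f : H)‖ ‖B f‖ ≤ _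
    refine max_le ?_ ?_ <;>
    · refine le_of_sq_le_sq ?_ (norm_nonneg _)
      rw [h4]
      nlinarith [sq_nonneg ‖B f‖, sq_nonneg ‖(f : H)‖]
  have hcl : _root_.IsClosed (LinearMap.range L : Set H) := by
    have : CompleteSpace B.graph := hB.isClosed.completeSpace_coe
    have hc : Continuous L :=
      ((continuous_snd.sub (continuous_fst.const_smul Complex.I))).comp continuous_subtype_val
    have ha : AntilipschitzWith 1 L := by
      refine AddMonoidHomClass.antilipschitz_of_bound L fun p => ?_
      simpa using hnorm p
    have huc : UniformContinuous L :=
      (⟨L, hc⟩ : B.graph →L[ℂ] H).uniformContinuous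
    rw [LinearMap.coe_range]
    exact ha.isClosed_range huc
  have htop : LinearMap.range L = ⊤ := by
    rw [← hcl.submodule_topologicalClosure_eq, Submodule.topologicalClosure_eq_top_iff,
      Submodule.eq_bot_iff]
    intro u hu
    rw [Submodule.mem_orthogonal] at hu
    have h1 : ∀ f : B.domain, inner ℂ (-Complex.I • u) (f : H) = inner ℂ u (B f) := by
      intro f
      have h2 := hu _ ⟨⟨_, B.mem_graph f⟩, rfl⟩
      rw [hLap, inner_sub_left, sub_eq_zero] at h2
      have h3 := congrArg (starRingEnd ℂ) h2
      rw [inner_conj_symm, inner_conj_symm, inner_smul_right] at h3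
      rw [h3, inner_smul_left]
      simp
    have hu' : u ∈ B†.domain := LinearPMap.mem_adjoint_domain_of_exists _ ⟨_, h1⟩
    have e1 : B† ⟨u, hu'⟩ = -Complex.I • u := LinearPMap.adjoint_apply_eq hd _ h1
    have hu2 : u ∈ B.domain := by rwa [hadj] at hu'
    have e2 : B ⟨u, hu2⟩ = -Complex.I • u := by rw [← e1]; exact hadj.ge.2 rfl
    have h4 := hsym ⟨u, hu2⟩ ⟨u, hu2⟩
    rw [e2, inner_smul_left, inner_smul_right, ← sub_eq_zero, ← sub_mul] at h4
    have h5 : (starRingEnd ℂ) (-Complex.I) - -Complex.I ≠ 0 := by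
      simp [Complex.ext_iff]
    exact inner_self_eq_zero.mp ((mul_eq_zero.mp h4).resolve_left h5)
  obtain ⟨⟨p, hp⟩, hpv⟩ := (htop ▸ Submodule.mem_top : v ∈ LinearMap.range L)
  obtain ⟨f, rfl⟩ := (LinearPMap.mem_graph_iff' B).mp hp
  exact ⟨f, hpv⟩

end Extensions

section Triple

variable {H : Type*} [NormedAddCommGroup H] [InnerProductSpace ℂ H] [CompleteSpace H]
  {ι : Type*} [Fintype ι] {T B : H →ₗ.[ℂ] H}
  {Γ₁ Γ₂ : T†.domain →ₗ[ℂ] (ι → ℂ)} {c : ℂ}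

/-- A boundary triple for the adjoint of a densely defined symmetric operator `T`, in the form
adapted to unitary boundary conditions `Γ₁ f = W Γ₂ f`: two boundary maps, jointly onto, vanishing
together only on the domain of `T`, in terms of which the boundary form of `T†` is a difference of
two inner products. -/
structure IsBoundaryTriple (T : H →ₗ.[ℂ] H) (Γ₁ Γ₂ : T†.domain →ₗ[ℂ] (ι → ℂ)) (c : ℂ) : Prop where
  dense : Dense (T.domain : Set H)
  symm : T.IsFormalAdjoint T
  ne_zero : c ≠ 0
  form : ∀ f h : T†.domain, inner ℂ (T† f) (h : H) - inner ℂ (f : H) (T† h) =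
    c * (star (Γ₁ f) ⬝ᵥ Γ₁ h - star (Γ₂ f) ⬝ᵥ Γ₂ h)
  surj : ∀ x y : ι → ℂ, ∃ f, Γ₁ f = x ∧ Γ₂ f = y
  mem_domain : ∀ f, Γ₁ f = 0 → Γ₂ f = 0 → (f : H) ∈ T.domain

namespace IsBoundaryTriple

theorem form_eq_iff (hΓ : IsBoundaryTriple T Γ₁ Γ₂ c) (f h : T†.domain) :
    inner ℂ (T† f) (h : H) = inner ℂ (f : H) (T† h) ↔
      star (Γ₁ f) ⬝ᵥ Γ₁ h = star (Γ₂ f) ⬝ᵥ Γ₂ h := by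
  rw [← sub_eq_zero, hΓ.form, mul_eq_zero, or_iff_right hΓ.ne_zero, sub_eq_zero]

/-- The boundary values vanish on the domain of the closure of `T`. -/
theorem eq_zero_of_mem_closure (hΓ : IsBoundaryTriple T Γ₁ Γ₂ c) (f : T†.domain)
    (hf : (f : H) ∈ T.closure.domain) : Γ₁ f = 0 ∧ Γ₂ f = 0 := by
  have hle := closure_le_adjoint hΓ.dense hΓ.symm
  have hc : T.IsClosable := (LinearPMap.adjoint_isClosed hΓ.dense).isClosable.leIsClosable
    (LinearPMap.IsFormalAdjoint.le_adjoint hΓ.dense hΓ.symm)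
  -- the symmetry relation against `T†` passes to the closure of the graph of `T`
  have key : ∀ h : T†.domain, inner ℂ (T† h) (f : H) = inner ℂ (h : H) (T† f) := by
    intro h
    have hcl : _root_.IsClosed {p : H × H | inner ℂ (T† h) p.1 = inner ℂ (h : H) p.2} :=
      isClosed_eq (by fun_prop) (by fun_prop)
    have hg : ((f : H), T.closure ⟨f, hf⟩) ∈ T.closure.graph := T.closure.mem_graph ⟨f, hf⟩
    rw [← hc.graph_closure_eq_closure_graph] at hg
    have e : T.closure ⟨f, hf⟩ = T† f := hle.2 rfl
    rw [e] at hg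
    refine closure_minimal (fun p hp => ?_) hcl hg
    obtain ⟨x, rfl⟩ := (LinearPMap.mem_graph_iff' T).mp hp
    exact LinearPMap.adjoint_isFormalAdjoint hΓ.dense h x
  have key2 : ∀ x y : ι → ℂ, star x ⬝ᵥ Γ₁ f = star y ⬝ᵥ Γ₂ f := by
    intro x y
    obtain ⟨h, rfl, rfl⟩ := hΓ.surj x y
    exact (hΓ.form_eq_iff h f).mp (key h)
  constructor
  · have := key2 (Γ₁ f) 0
    rw [star_zero, zero_dotProduct] at this
    exact eq_zero_of_star_dotProduct_self this
  · have := key2 0 (Γ₂ f)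
    rw [star_zero, zero_dotProduct] at this
    exact eq_zero_of_star_dotProduct_self this.symm

/-- A unitary boundary condition defines a self-adjoint extension. -/
theorem isSelfAdjoint_of_domain [DecidableEq ι] (hΓ : IsBoundaryTriple T Γ₁ Γ₂ c) (hB : B ≤ T†)
    {W : Matrix ι ι ℂ} (hW : W ∈ Matrix.unitaryGroup ι ℂ)
    (h : ∀ f : T†.domain, (f : H) ∈ B.domain ↔ Γ₁ f = W *ᵥ Γ₂ f) :
    T ≤ B ∧ IsSelfAdjoint B := by
  have hT : T ≤ T† := LinearPMap.IsFormalAdjoint.le_adjoint hΓ.dense hΓ.symm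
  have hTB : T ≤ B := by
    have hdom : T.domain ≤ B.domain := by
      intro x hx
      obtain ⟨h1, h2⟩ := hΓ.eq_zero_of_mem_closure ⟨x, hT.1 hx⟩ (T.le_closure.1 hx)
      rw [h ⟨x, hT.1 hx⟩, h1, h2, Matrix.mulVec_zero]
    refine ⟨hdom, fun x y hxy => ?_⟩
    rw [hT.2 (y := ⟨x, hT.1 x.2⟩) rfl, hB.2 (y := ⟨x, hT.1 x.2⟩) hxy.symm]
  refine ⟨hTB, (isSelfAdjoint_iff_lagrangian hΓ.dense hTB hB).mpr fun g => ?_⟩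
  have hWW : Wᴴ * W = 1 := Matrix.mem_unitaryGroup_iff'.mp hW
  have hWW' : W * Wᴴ = 1 := Matrix.mem_unitaryGroup_iff.mp hW
  have hadj : ∀ x y : ι → ℂ, star (W *ᵥ x) ⬝ᵥ y = star x ⬝ᵥ (Wᴴ *ᵥ y) := by
    intro x y
    rw [Matrix.star_mulVec, Matrix.dotProduct_mulVec]
  rw [h g]
  constructor
  · intro hg f hf
    rw [hΓ.form_eq_iff, (h f).mp hf, hg, hadj, Matrix.mulVec_mulVec, hWW, Matrix.one_mulVec]
  · intro hg
    have key : ∀ y : ι → ℂ, star y ⬝ᵥ (Wᴴ *ᵥ Γ₁ g - Γ₂ g) = 0 := by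
      intro y
      obtain ⟨f, h1, h2⟩ := hΓ.surj (W *ᵥ y) y
      have := (hΓ.form_eq_iff f g).mp (hg f ((h f).mpr (by rw [h1, h2])))
      rw [h1, h2, hadj] at this
      rw [dotProduct_sub, this, sub_self]
    have h0 := eq_zero_of_star_dotProduct_self (key (Wᴴ *ᵥ Γ₁ g - Γ₂ g))
    rw [← sub_eq_zero.mp h0, Matrix.mulVec_mulVec, hWW', Matrix.one_mulVec]

/-- Every self-adjoint extension is given by a unitary boundary condition: the boundary values form
a Lagrangian subspace, which is the graph of a unitary map. -/
theorem exists_unitary_of_isSelfAdjoint [DecidableEq ι] (hΓ : IsBoundaryTriple T Γ₁ Γ₂ c)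
    (hTB : T ≤ B) (hB : IsSelfAdjoint B) : B ≤ T† ∧ ∃ W ∈ Matrix.unitaryGroup ι ℂ,
      ∀ f : T†.domain, (f : H) ∈ B.domain ↔ Γ₁ f = W *ᵥ Γ₂ f := by
  have hBT : B ≤ T† := by
    have := adjoint_le_adjoint hΓ.dense hTB
    rwa [LinearPMap.isSelfAdjoint_def.mp hB] at this
  refine ⟨hBT, ?_⟩
  have hL : ∀ h : T†.domain, (h : H) ∈ B.domain ↔ ∀ f : T†.domain, (f : H) ∈ B.domain →
      star (Γ₁ f) ⬝ᵥ Γ₁ h = star (Γ₂ f) ⬝ᵥ Γ₂ h := by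
    intro h
    rw [(isSelfAdjoint_iff_lagrangian hΓ.dense hTB hBT).mp hB h]
    simp only [hΓ.form_eq_iff]
  -- the second boundary values of elements of the domain exhaust the whole space, since an element
  -- with boundary values `0` and `y`, where `y` is orthogonal to them, lies in the domain,
  -- so that `y = 0` by isotropy
  let D : Submodule ℂ T†.domain := B.domain.comap T†.domain.subtype
  have hD : ∀ f : T†.domain, f ∈ D ↔ (f : H) ∈ B.domain := fun f => Iff.rfl
  have hsurj : ∀ y : ι → ℂ, ∃ f : T†.domain, (f : H) ∈ B.domain ∧ Γ₂ f = y := by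
    let K : Submodule ℂ (EuclideanSpace ℂ ι) :=
      (D.map Γ₂).map (WithLp.linearEquiv 2 ℂ (ι → ℂ)).symm.toLinearMap
    have hK : K = ⊤ := by
      rw [← Submodule.orthogonal_eq_bot_iff, Submodule.eq_bot_iff]
      intro y hy
      rw [Submodule.mem_orthogonal] at hy
      obtain ⟨h, h1, h2⟩ := hΓ.surj 0 (WithLp.ofLp y)
      have hm : (h : H) ∈ B.domain := by
        rw [hL]
        intro f hf
        have := hy (WithLp.toLp 2 (Γ₂ f)) ⟨Γ₂ f, ⟨f, hf, rfl⟩, rfl⟩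
        rw [EuclideanSpace.inner_eq_star_dotProduct] at this
        rw [h1, h2, dotProduct_zero, dotProduct_comm]
        exact this.symm
      have h3 := (hL h).mp hm h hm
      rw [h1, h2, dotProduct_zero] at h3
      have h4 := eq_zero_of_star_dotProduct_self h3.symm
      ext i
      exact congrFun h4 i
    intro y
    have : WithLp.toLp 2 y ∈ K := hK ▸ Submodule.mem_top
    obtain ⟨_, ⟨f, hf, rfl⟩, e⟩ := this
    exact ⟨f, hf, congrArg WithLp.ofLp e⟩
  choose F hF hFy using hsurj
  -- the columns of `W` are the first boundary values where the second ones are the unit vectors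
  let W : Matrix ι ι ℂ := Matrix.of fun i j => Γ₁ (F (Pi.single j 1)) i
  have hWf : ∀ f : T†.domain, (f : H) ∈ B.domain → Γ₁ f = W *ᵥ Γ₂ f := by
    intro f hf
    -- subtracting elements of the domain makes the second boundary value zero; by isotropy the
    -- first one then vanishes as well
    let r : T†.domain := f - ∑ j, Γ₂ f j • F (Pi.single j 1)
    have hr : (r : H) ∈ B.domain := by
      rw [← hD]
      exact D.sub_mem hf (D.sum_mem fun j _ => D.smul_mem _ (hF _))
    have r2 : Γ₂ r = 0 := by
      simp only [r, map_sub, map_sum, map_smul, hFy]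
      ext i
      simp [Finset.sum_apply, Pi.single_apply]
    have r1 : Γ₁ r = 0 := by
      have := (hL r).mp hr r hr
      rw [r2, dotProduct_zero] at this
      exact eq_zero_of_star_dotProduct_self this
    simp only [r, map_sub, map_sum, map_smul, sub_eq_zero] at r1
    rw [r1]
    ext i
    simp [W, Matrix.mulVec, dotProduct, Finset.sum_apply, mul_comm]
  have hWu : W ∈ Matrix.unitaryGroup ι ℂ := by
    rw [Matrix.mem_unitaryGroup_iff']
    ext i j
    have := (hL (F (Pi.single j 1))).mp (hF _) (F (Pi.single i 1)) (hF _)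
    rw [hFy, hFy] at this
    rw [Matrix.star_eq_conjTranspose, Matrix.mul_apply]
    simp only [Matrix.conjTranspose_apply, W, Matrix.of_apply]
    refine Eq.trans ?_ (this.trans ?_)
    · rfl
    · rw [← Pi.single_star, star_one, single_one_dotProduct, Matrix.one_apply, Pi.single_apply]
  refine ⟨W, hWu, fun f => ⟨hWf f, fun hf => (hL f).mpr fun g hg => ?_⟩⟩
  rw [hWf g hg, hf, Matrix.star_mulVec, Matrix.dotProduct_mulVec, Matrix.vecMul_vecMul,
    ← Matrix.star_eq_conjTranspose, Matrix.mem_unitaryGroup_iff'.mp hWu, Matrix.vecMul_one]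

/-- A deficiency vector satisfying the self-adjoint boundary condition `Γ₁ u = Γ₂ u` vanishes. -/
theorem eq_zero_of_deficiency (hΓ : IsBoundaryTriple T Γ₁ Γ₂ c) {z : ℂ} (hz : z.im ≠ 0)
    (u : T†.domain) (hu : T† u = z • (u : H)) (h : Γ₁ u = Γ₂ u) : (u : H) = 0 := by
  have h4 := (hΓ.form_eq_iff u u).mpr (by rw [h])
  rw [hu, inner_smul_left, inner_smul_right, ← sub_eq_zero, ← sub_mul] at h4
  have h5 : (starRingEnd ℂ) z - z ≠ 0 := by
    intro h0
    have := congrArg Complex.im h0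
    simp only [Complex.sub_im, Complex.conj_im, Complex.zero_im] at this
    exact hz (by linarith)
  exact inner_self_eq_zero.mp ((mul_eq_zero.mp h4).resolve_left h5)

/-- The operator `T† - i` has kernel vectors with prescribed `Γ₁ u - Γ₂ u`: correct an arbitrary
vector with these boundary values by an element of the domain of the self-adjoint extension with
boundary condition `Γ₁ f = Γ₂ f`. -/
theorem exists_deficiency [DecidableEq ι] (hΓ : IsBoundaryTriple T Γ₁ Γ₂ c) (d : ι → ℂ) :
    ∃ u : T†.domain, T† u = Complex.I • (u : H) ∧ Γ₁ u - Γ₂ u = d := by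
  let S : Submodule ℂ H := (LinearMap.ker (Γ₁ - Γ₂)).map T†.domain.subtype
  have hS : ∀ f : T†.domain, (f : H) ∈ (T†.domRestrict S).domain ↔
      Γ₁ f = (1 : Matrix ι ι ℂ) *ᵥ Γ₂ f := by
    intro f
    rw [Matrix.one_mulVec, ← sub_eq_zero]
    constructor
    · rintro ⟨⟨g, hg, e⟩, -⟩
      obtain rfl : g = f := Subtype.ext e
      exact hg
    · intro h
      exact ⟨⟨f, h, rfl⟩, f.2⟩
  have hB := (hΓ.isSelfAdjoint_of_domain LinearPMap.domRestrict_le (one_mem _) hS).2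
  obtain ⟨h, h1, h2⟩ := hΓ.surj d 0
  obtain ⟨f, hf⟩ := exists_apply_sub_eq hB (T† h - Complex.I • (h : H))
  have hle : T†.domRestrict S ≤ T† := LinearPMap.domRestrict_le
  have ef : T†.domRestrict S f = T† ⟨f, hle.1 f.2⟩ := hle.2 rfl
  have hf0 := (hS ⟨f, hle.1 f.2⟩).mp f.2
  rw [Matrix.one_mulVec] at hf0
  refine ⟨h - ⟨f, hle.1 f.2⟩, ?_, ?_⟩
  · rw [T†.map_sub, ← ef, AddSubgroupClass.coe_sub, smul_sub, sub_eq_sub_iff_sub_eq_sub, ← hf]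
  · rw [map_sub, map_sub, h1, h2, hf0]
    abel

theorem deficiencySpace_le (z : ℂ) : deficiencySpace T z ≤ T†.domain := fun _ hu => hu.1

/-- The deficiency spaces have at most the dimension of the space of boundary values. -/
theorem finrank_deficiencySpace_le (hΓ : IsBoundaryTriple T Γ₁ Γ₂ c) {z : ℂ} (hz : z.im ≠ 0) :
    FiniteDimensional ℂ (deficiencySpace T z) ∧
      Module.finrank ℂ (deficiencySpace T z) ≤ Fintype.card ι := by
  let L : deficiencySpace T z →ₗ[ℂ] (ι → ℂ) :=
    (Γ₁ - Γ₂) ∘ₗ Submodule.inclusion (deficiencySpace_le z)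
  have hL : Function.Injective L := by
    rw [← LinearMap.ker_eq_bot, Submodule.eq_bot_iff]
    intro u hu
    have h : Γ₁ (Submodule.inclusion (deficiencySpace_le z) u) -
      Γ₂ (Submodule.inclusion (deficiencySpace_le z) u) = 0 := hu
    exact Subtype.ext (hΓ.eq_zero_of_deficiency hz
      (Submodule.inclusion (deficiencySpace_le z) u) u.2.2 (sub_eq_zero.mp h))
  refine ⟨Module.Finite.of_injective L hL, ?_⟩
  have := LinearMap.finrank_le_finrank_of_injective hL
  rwa [Module.finrank_fintype_fun_eq_card] at this

end IsBoundaryTriple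

end Triple

/-! ### The linear fractional transformation of unitary matrices -/

section Matrices

theorem half_smul_two {n : Type*} [DecidableEq n] : (1 / 2 : ℂ) • (2 : Matrix n n ℂ) = 1 := by
  rw [show (2 : Matrix n n ℂ) = (2 : ℂ) • 1 by rw [two_smul, one_add_one_eq_two], smul_smul]
  norm_num

open scoped ComplexOrder in
theorem vecMul_eq_zero_of_gram {n : Type*} [Fintype n] {M : Matrix n n ℂ} {v : n → ℂ}
    (hv : v ᵥ* (M * Mᴴ) = 0) :
    v ᵥ* M = 0 :=
  (Matrix.vecMul_self_mul_conjTranspose_eq_zero M v).mp hv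

variable {n : Type*} [Fintype n] [DecidableEq n] {E F X W : Matrix n n ℂ}

theorem isUnit_of_vecMul {M : Matrix n n ℂ} (h : ∀ v, v ᵥ* M = 0 → v = 0) : IsUnit M := by
  rw [← Matrix.vecMul_injective_iff_isUnit, ← Matrix.coe_vecMulLinear]
  exact (injective_iff_map_eq_zero M.vecMulLinear).mpr h

theorem isUnit_of_mulVec {M : Matrix n n ℂ} (h : ∀ v, M *ᵥ v = 0 → v = 0) : IsUnit M := by
  rw [← Matrix.mulVec_injective_iff_isUnit, ← Matrix.coe_mulVecLin]
  exact (injective_iff_map_eq_zero M.mulVecLin).mpr h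

/-- Two commuting normal matrices with `E Eᴴ = F Fᴴ + 2`. They define the linear fractional map
`X ↦ (E + X F)⁻¹ (Fᴴ + X Eᴴ)`, which preserves unitarity. -/
structure IsHyperbolicPair (E F : Matrix n n ℂ) : Prop where
  comm : E * F = F * E
  comm' : Eᴴ * F = F * Eᴴ
  normal_left : E * Eᴴ = Eᴴ * E
  normal_right : F * Fᴴ = Fᴴ * F
  diff : E * Eᴴ = F * Fᴴ + 2

namespace IsHyperbolicPair

theorem comm_conj (h : IsHyperbolicPair E F) : E * Fᴴ = Fᴴ * E := by
  have := congrArg Matrix.conjTranspose h.comm'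
  simpa [Matrix.conjTranspose_mul] using this.symm

theorem comm_conj' (h : IsHyperbolicPair E F) : Eᴴ * Fᴴ = Fᴴ * Eᴴ := by
  have := congrArg Matrix.conjTranspose h.comm
  simpa [Matrix.conjTranspose_mul] using this.symm

/-- The Gram matrices of denominator and numerator differ by the defect of unitarity of `X`. -/
theorem gram_identity (h : IsHyperbolicPair E F) (X : Matrix n n ℂ) :
    (E + X * F) * (E + X * F)ᴴ - (Fᴴ + X * Eᴴ) * (Fᴴ + X * Eᴴ)ᴴ = (2 : ℂ) • (1 - X * Xᴴ) := by
  simp only [Matrix.conjTranspose_add, Matrix.conjTranspose_mul, Matrix.conjTranspose_conjTranspose]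
  have e1 : E * Eᴴ = Fᴴ * F + 2 := by rw [h.diff, h.normal_right]
  have e2 : Eᴴ * E = F * Fᴴ + 2 := by rw [← h.normal_left, h.diff]
  calc _ = E * Eᴴ - Fᴴ * F + X * (F * Eᴴ - Eᴴ * F) + (E * Fᴴ - Fᴴ * E) * Xᴴ +
        X * (F * Fᴴ - Eᴴ * E) * Xᴴ := by noncomm_ring
    _ = _ := by
      rw [e1, e2, h.comm', h.comm_conj, two_smul, ← one_add_one_eq_two]
      noncomm_ring

theorem left_identity (h : IsHyperbolicPair E F) (X : Matrix n n ℂ) :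
    (E + X * F) * Eᴴ - (Fᴴ + X * Eᴴ) * F = 2 := by
  have e1 : E * Eᴴ = Fᴴ * F + 2 := by rw [h.diff, h.normal_right]
  calc _ = E * Eᴴ - Fᴴ * F + X * (F * Eᴴ - Eᴴ * F) := by noncomm_ring
    _ = _ := by
      rw [e1, h.comm']
      noncomm_ring

theorem right_identity (h : IsHyperbolicPair E F) (X : Matrix n n ℂ) :
    (Fᴴ + X * Eᴴ) * E - (E + X * F) * Fᴴ = (2 : ℂ) • X := by
  have e2 : Eᴴ * E = F * Fᴴ + 2 := by rw [← h.normal_left, h.diff]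
  calc _ = Fᴴ * E - E * Fᴴ + X * (Eᴴ * E - F * Fᴴ) := by noncomm_ring
    _ = _ := by
      rw [e2, h.comm_conj, two_smul]
      noncomm_ring

/-- For unitary `X`, a row vector killed by one of the two matrices is killed by both, since their
Gram matrices agree, and then vanishes by `left_identity`. -/
theorem isUnit (h : IsHyperbolicPair E F) (hX : X * Xᴴ = 1) :
    IsUnit (E + X * F) ∧ IsUnit (Fᴴ + X * Eᴴ) := by
  have hg := h.gram_identity X
  rw [hX, sub_self, smul_zero, sub_eq_zero] at hg
  have key : ∀ v : n → ℂ, v ᵥ* (E + X * F) = 0 → v ᵥ* (Fᴴ + X * Eᴴ) = 0 → v = 0 := by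
    intro v h1 h2
    have := congrArg (v ᵥ* ·) (h.left_identity X)
    simp only [Matrix.vecMul_sub, ← Matrix.vecMul_vecMul, h1, h2, Matrix.zero_vecMul,
      sub_self] at this
    rw [show (2 : Matrix n n ℂ) = (2 : ℂ) • 1 by rw [two_smul, one_add_one_eq_two],
      Matrix.vecMul_smul, Matrix.vecMul_one] at this
    exact (smul_eq_zero.mp this.symm).resolve_left two_ne_zero
  refine ⟨isUnit_of_vecMul fun v hv => key v hv (vecMul_eq_zero_of_gram ?_),
    isUnit_of_vecMul fun v hv => key v (vecMul_eq_zero_of_gram ?_) hv⟩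
  · rw [← hg, ← Matrix.vecMul_vecMul, hv, Matrix.zero_vecMul]
  · rw [hg, ← Matrix.vecMul_vecMul, hv, Matrix.zero_vecMul]

/-- The value of the linear fractional map is unitary exactly when its argument is. -/
theorem unitary_iff (h : IsHyperbolicPair E F) (hM : IsUnit (E + X * F)) :
    ((E + X * F)⁻¹ * (Fᴴ + X * Eᴴ)) * ((E + X * F)⁻¹ * (Fᴴ + X * Eᴴ))ᴴ = 1 ↔ X * Xᴴ = 1 := by
  have hg := h.gram_identity X
  set M := E + X * F
  set N := Fᴴ + X * Eᴴ
  have hdet : IsUnit M.det := (Matrix.isUnit_iff_isUnit_det M).mp hM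
  have hdet' : IsUnit Mᴴ.det := by rw [Matrix.det_conjTranspose]; exact hdet.star
  have e : (M⁻¹ * N) * (M⁻¹ * N)ᴴ = M⁻¹ * (N * Nᴴ) * (Mᴴ)⁻¹ := by
    rw [Matrix.conjTranspose_mul, Matrix.conjTranspose_nonsing_inv]
    noncomm_ring
  have hMN : (M⁻¹ * N) * (M⁻¹ * N)ᴴ = 1 ↔ M * Mᴴ = N * Nᴴ := by
    rw [e]
    constructor
    · intro h1
      have h2 := congrArg (fun Z => M * Z * Mᴴ) h1
      simp only [mul_one] at h2
      rw [← h2, ← mul_assoc, ← mul_assoc, Matrix.mul_nonsing_inv _ hdet, one_mul,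
        mul_assoc (N * Nᴴ), Matrix.nonsing_inv_mul _ hdet', mul_one]
    · intro h1
      rw [← h1, ← mul_assoc, Matrix.nonsing_inv_mul _ hdet, one_mul,
        Matrix.mul_nonsing_inv _ hdet']
  rw [hMN, ← sub_eq_zero, hg, smul_eq_zero, or_iff_right two_ne_zero, sub_eq_zero, eq_comm]

/-- The linear fractional map is injective: `left_identity` recovers the denominator from the value,
and `right_identity` recovers the argument from both. -/
theorem injective (h : IsHyperbolicPair E F) {Y : Matrix n n ℂ} (hX : IsUnit (E + X * F))
    (hY : IsUnit (E + Y * F))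
    (he : (E + X * F)⁻¹ * (Fᴴ + X * Eᴴ) = (E + Y * F)⁻¹ * (Fᴴ + Y * Eᴴ)) : X = Y := by
  have lX := h.left_identity X
  have lY := h.left_identity Y
  have rX := h.right_identity X
  have rY := h.right_identity Y
  set M := E + X * F
  set M' := E + Y * F
  set N := Fᴴ + X * Eᴴ
  set N' := Fᴴ + Y * Eᴴ
  have hdet : IsUnit M.det := (Matrix.isUnit_iff_isUnit_det M).mp hX
  have hdet' : IsUnit M'.det := (Matrix.isUnit_iff_isUnit_det M').mp hY
  have eN : N = M * (M⁻¹ * N) := by rw [← mul_assoc, Matrix.mul_nonsing_inv _ hdet, one_mul]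
  have eN' : N' = M' * (M⁻¹ * N) := by
    rw [he, ← mul_assoc, Matrix.mul_nonsing_inv _ hdet', one_mul]
  have e1 : M * (Eᴴ - M⁻¹ * N * F) = 2 := by
    rw [← lX, mul_sub]
    conv_rhs => rw [eN]
    noncomm_ring
  have e2 : M' * (Eᴴ - M⁻¹ * N * F) = 2 := by
    rw [← lY, mul_sub]
    conv_rhs => rw [eN']
    noncomm_ring
  have eM : M = M' := by
    have h2 : M * ((1 / 2 : ℂ) • (Eᴴ - M⁻¹ * N * F)) = 1 := by
      rw [Matrix.mul_smul, e1, half_smul_two]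
    have h3 : M' * ((1 / 2 : ℂ) • (Eᴴ - M⁻¹ * N * F)) = 1 := by
      rw [Matrix.mul_smul, e2, half_smul_two]
    have h4 := mul_eq_one_comm.mp h2
    calc M = M' * ((1 / 2 : ℂ) • (Eᴴ - M⁻¹ * N * F)) * M := by rw [h3, one_mul]
      _ = M' := by rw [mul_assoc, h4, mul_one]
  have : (2 : ℂ) • X = (2 : ℂ) • Y := by
    rw [← rX, ← rY, eN', ← eM, ← eN]
  exact smul_right_injective _ two_ne_zero this

/-- Every unitary matrix is a value of the linear fractional map. -/
theorem surjective (h : IsHyperbolicPair E F) (hW : Wᴴ * W = 1) :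
    ∃ X : Matrix n n ℂ, IsUnit (E + X * F) ∧ (E + X * F)⁻¹ * (Fᴴ + X * Eᴴ) = W := by
  -- `N v = 0` forces `‖Eᴴ v‖ = ‖F v‖`, whereas `‖Eᴴ v‖² = ‖F v‖² + 2 ‖v‖²`
  have hN : IsUnit (Eᴴ - W * F) := by
    refine isUnit_of_mulVec fun v hv => ?_
    rw [Matrix.sub_mulVec, sub_eq_zero] at hv
    have gram : ∀ A : Matrix n n ℂ, star (A *ᵥ v) ⬝ᵥ (A *ᵥ v) = star v ⬝ᵥ ((Aᴴ * A) *ᵥ v) := by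
      intro A
      rw [Matrix.star_mulVec, ← Matrix.dotProduct_mulVec, Matrix.mulVec_mulVec]
    have h1 := gram Eᴴ
    rw [hv, gram (W * F), Matrix.conjTranspose_mul, mul_assoc, ← mul_assoc Wᴴ, hW, one_mul,
      Matrix.conjTranspose_conjTranspose, h.diff, h.normal_right, Matrix.add_mulVec,
      dotProduct_add, left_eq_add, ← one_add_one_eq_two, Matrix.add_mulVec, Matrix.one_mulVec,
      dotProduct_add, ← two_mul] at h1
    exact eq_zero_of_star_dotProduct_self ((mul_eq_zero.mp h1).resolve_left two_ne_zero)
  have hdet := (Matrix.isUnit_iff_isUnit_det _).mp hN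
  set N := Eᴴ - W * F with hNdef
  -- `left_identity` forces the denominator `M = 2 N⁻¹`, and `right_identity` then gives `X`
  set M := (2 : ℂ) • N⁻¹ with hMdef
  have hMN : M * N = 2 := by
    rw [hMdef, Matrix.smul_mul, Matrix.nonsing_inv_mul _ hdet, two_smul, one_add_one_eq_two]
  have hM : IsUnit M := by
    have : M * ((1 / 2 : ℂ) • N) = 1 := by
      rw [Matrix.mul_smul, hMN, half_smul_two]
    exact IsUnit.of_mul_eq_one _ this
  have e2 : Eᴴ * E = Fᴴ * F + 2 := by rw [← h.normal_left, h.diff, h.normal_right]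
  have hinj : Function.Injective fun Z : Matrix n n ℂ => (2 : ℂ) • Z :=
    smul_right_injective _ two_ne_zero
  have eM : E + ((1 / 2 : ℂ) • (M * W * E - M * Fᴴ)) * F = M := by
    apply hinj
    have h1 : (2 : ℂ) • E = M * N * E := by rw [hMN, two_smul, two_mul]
    simp only [smul_add, Matrix.smul_mul, smul_smul]
    rw [h1, hNdef]
    norm_num
    calc M * (Eᴴ - W * F) * E + (M * W * E - M * Fᴴ) * F =
        M * (Eᴴ * E - Fᴴ * F) + M * W * (E * F - F * E) := by noncomm_ring
      _ = (2 : ℂ) • M := by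
        rw [e2, h.comm, two_smul]
        noncomm_ring
  have eN : Fᴴ + ((1 / 2 : ℂ) • (M * W * E - M * Fᴴ)) * Eᴴ = M * W := by
    apply hinj
    have h1 : (2 : ℂ) • Fᴴ = M * N * Fᴴ := by rw [hMN, two_smul, two_mul]
    simp only [smul_add, Matrix.smul_mul, smul_smul]
    rw [h1, hNdef]
    norm_num
    calc M * (Eᴴ - W * F) * Fᴴ + (M * W * E - M * Fᴴ) * Eᴴ =
        M * (Eᴴ * Fᴴ - Fᴴ * Eᴴ) + M * W * (E * Eᴴ - F * Fᴴ) := by noncomm_ring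
      _ = (2 : ℂ) • (M * W) := by
        rw [h.diff, h.comm_conj', two_smul]
        noncomm_ring
  refine ⟨(1 / 2 : ℂ) • (M * W * E - M * Fᴴ), by rwa [eM], ?_⟩
  rw [eM, eN, ← mul_assoc, Matrix.nonsing_inv_mul _ ((Matrix.isUnit_iff_isUnit_det _).mp hM),
    one_mul]

end IsHyperbolicPair
end Matrices

/-! ### The boundary triple of the minimal operator -/

section Deficiency

variable {a : ℝ} {V : ℝ → ℝ} {f g gp gm : ℝ → ℂ} {z : ℂ}

theorem isBoundaryTriple_minimalOp (ha : 0 < a) (hV : IsPotential a V) :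
    IsBoundaryTriple (minimalOp ha hV) (outMap ha hV) (inMap ha hV) (-(Complex.I / 2)) where
  dense := dense_minimalOp_domain ha hV
  symm := isFormalAdjoint_minimalOp ha hV
  ne_zero := by simp
  form u v := by
    obtain ⟨f, hf, hu⟩ := exists_isAC2_of_mem_adjoint ha hV u
    obtain ⟨g, hg, hv⟩ := exists_isAC2_of_mem_adjoint ha hV v
    rw [outMap_eq ha hV u hf hu, outMap_eq ha hV v hg hv, inMap_eq ha hV u hf hu,
      inMap_eq ha hV v hg hv]
    obtain rfl : u = ⟨_, hf.toL2_mem_adjoint ha hV⟩ := Subtype.ext hu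
    obtain rfl : v = ⟨_, hg.toL2_mem_adjoint ha hV⟩ := Subtype.ext hv
    rw [hf.adjoint_toL2 ha hV, hg.adjoint_toL2 ha hV, inner_opL2_sub ha hV hf hg]
    simp only [outVec, inVec, dotProduct, Fin.sum_univ_two, Pi.star_apply, Matrix.cons_val_zero,
      Matrix.cons_val_one, RCLike.star_def, map_add, map_sub, map_mul, Complex.conj_I]
    linear_combination ((starRingEnd ℂ) (f a) * d1 a g a - (starRingEnd ℂ) (d1 a f a) * g a
      - (starRingEnd ℂ) (f (-a)) * d1 a g (-a)
      + (starRingEnd ℂ) (d1 a f (-a)) * g (-a)) * Complex.I_sq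
  surj x y := by
    obtain ⟨f, hf, h1, h2⟩ := exists_isAC2_vec ha x y
    refine ⟨⟨_, hf.toL2_mem_adjoint ha hV⟩, ?_, ?_⟩
    · rw [outMap_eq ha hV _ hf rfl, h1]
    · rw [inMap_eq ha hV _ hf rfl, h2]
  mem_domain u h1 h2 := by
    obtain ⟨f, hf, hu⟩ := exists_isAC2_of_mem_adjoint ha hV u
    rw [outMap_eq ha hV u hf hu] at h1
    rw [inMap_eq ha hV u hf hu] at h2
    have e1 := congrFun h1 0
    have e2 := congrFun h1 1
    have e3 := congrFun h2 0
    have e4 := congrFun h2 1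
    simp only [outVec, inVec, Matrix.cons_val_zero, Matrix.cons_val_one, Pi.zero_apply]
      at e1 e2 e3 e4
    have hI : (2 * Complex.I) ≠ 0 := by simp
    have hm : IsMinimal a f := by
      refine ⟨hf, ?_, ?_, ?_, ?_⟩
      · exact (mul_eq_zero.mp (show 2 * Complex.I * f a = 0 by
          linear_combination e3 - e1)).resolve_left hI
      · exact (mul_eq_zero.mp (show 2 * Complex.I * f (-a) = 0 by
          linear_combination e2 - e4)).resolve_left hI
      · linear_combination (e1 + e3) / 2
      · linear_combination (e2 + e4) / 2
    rw [hu]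
    exact hm.toL2_mem ha hV

/-! ### Deficiency solutions -/

theorem IsAC2.toL2_mem_deficiencySpace (ha : 0 < a) (hV : IsPotential a V) (hf : IsAC2 a f) :
    hf.toL2 ∈ deficiencySpace (minimalOp ha hV) z ↔
      formalOp a V f =ᵐ[boxMeasure a] fun x => z * f x := by
  have h1 : z • hf.toL2 =ᵐ[boxMeasure a] fun x => z * f x := by
    filter_upwards [Lp.coeFn_smul z hf.toL2, hf.coeFn_toL2] with x h1 h2
    rw [h1, Pi.smul_apply, h2, smul_eq_mul]
  constructor
  · rintro ⟨h, e⟩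
    rw [hf.adjoint_toL2 ha hV] at e
    have := hf.coeFn_opL2 hV
    rw [e] at this
    exact this.symm.trans h1
  · intro h
    refine ⟨hf.toL2_mem_adjoint ha hV, ?_⟩
    rw [hf.adjoint_toL2 ha hV]
    exact Lp.ext ((hf.coeFn_opL2 hV).trans (h.trans h1.symm))

/-- A solution of `-f'' + V f = i f` with vanishing Dirichlet data is zero. -/
theorem eqOn_zero_of_dirichlet (ha : 0 < a) (hV : IsPotential a V) (hf : IsAC2 a f)
    (he : formalOp a V f =ᵐ[boxMeasure a] fun x => Complex.I * f x) (hr : f a = 0)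
    (hl : f (-a) = 0) : EqOn f 0 (Icc (-a) a) := by
  obtain ⟨h, e⟩ := (hf.toL2_mem_deficiencySpace ha hV).mpr he
  have h0 := (isBoundaryTriple_minimalOp ha hV).eq_zero_of_deficiency (z := Complex.I) (by simp)
    ⟨_, h⟩ e (by
      rw [outMap_eq ha hV _ hf rfl, inMap_eq ha hV _ hf rfl]
      simp [outVec, inVec, hr, hl])
  exact hf.eqOn_of_ae_eq ha isAC2_zero
    (hf.coeFn_toL2.symm.trans (by rw [show hf.toL2 = 0 from h0]; exact Lp.coeFn_zero _ _ _))

/-- The Dirichlet problem for `-f'' + V f = i f` is solvable. -/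
theorem exists_solution_dirichlet (ha : 0 < a) (hV : IsPotential a V) (α β : ℂ) :
    ∃ f, IsAC2 a f ∧ (formalOp a V f =ᵐ[boxMeasure a] fun x => Complex.I * f x) ∧
      f a = α ∧ f (-a) = β := by
  obtain ⟨u, hu, hd⟩ := (isBoundaryTriple_minimalOp ha hV).exists_deficiency
    ![-2 * Complex.I * α, 2 * Complex.I * β]
  obtain ⟨f, hf, huf⟩ := exists_isAC2_of_mem_adjoint ha hV u
  rw [outMap_eq ha hV u hf huf, inMap_eq ha hV u hf huf] at hd
  have e0 := congrFun hd 0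
  have e1 := congrFun hd 1
  simp only [outVec, inVec, Matrix.cons_val_zero, Matrix.cons_val_one, Pi.sub_apply] at e0 e1
  have hI : (2 * Complex.I) ≠ 0 := by simp
  refine ⟨f, hf, ?_, ?_, ?_⟩
  · rw [← hf.toL2_mem_deficiencySpace ha hV, ← huf]
    exact ⟨u.2, hu⟩
  · exact mul_left_cancel₀ hI (by linear_combination -e0)
  · exact mul_left_cancel₀ hI (by linear_combination e1)

theorem ae_mem_box (a : ℝ) : ∀ᵐ x ∂boxMeasure a, x ∈ Icc (-a) a :=
  ae_restrict_mem measurableSet_Icc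

/-- The differential expression commutes with the reflection `x ↦ -x`. -/
theorem formalOp_comp_neg (ha : 0 < a) (hV : IsPotential a V) (hf : IsAC2 a f)
    (he : formalOp a V f =ᵐ[boxMeasure a] fun x => z * f x) :
    formalOp a V (fun x => f (-x)) =ᵐ[boxMeasure a] fun x => z * f (-x) := by
  filter_upwards [(isAC2_comp_neg ha hf).2.2, ae_mem_box a,
    (measurePreserving_neg_box a).quasiMeasurePreserving.ae he] with x h1 hx h2
  rw [← h2, formalOp, formalOp, h1, hV.even x hx]

theorem formalOp_conj (ha : 0 < a) (hf : IsAC2 a f)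
    (he : formalOp a V f =ᵐ[boxMeasure a] fun x => z * f x) :
    formalOp a V (fun x => (starRingEnd ℂ) (f x)) =ᵐ[boxMeasure a]
      fun x => (starRingEnd ℂ) z * (starRingEnd ℂ) (f x) := by
  filter_upwards [(isAC2_conj ha hf).2.2, he] with x h1 h2
  rw [← map_mul, ← h2, formalOp, formalOp, h1]
  simp

theorem norm_toL2_sq (hf : IsAC2 a f) : ‖hf.toL2‖ ^ 2 = ∫ x, ‖f x‖ ^ 2 ∂boxMeasure a := by
  have h := inner_box hf.coeFn_toL2 hf.coeFn_toL2
  rw [inner_self_eq_norm_sq_to_K] at h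
  have h2 : ∫ x, (starRingEnd ℂ) (f x) * f x ∂boxMeasure a =
      ((∫ x, ‖f x‖ ^ 2 ∂boxMeasure a : ℝ) : ℂ) := by
    rw [← integral_complex_ofReal]
    refine integral_congr_ae (Filter.Eventually.of_forall fun x => ?_)
    simp only [Complex.conj_mul', Complex.ofReal_pow]
  rw [h2] at h
  exact Complex.ofReal_injective (by rw [Complex.ofReal_pow]; exact h)

/-- There is a normalized solution of either parity `s = ±1`: the solution with boundary values
`f(a) = 1`, `f(-a) = s` inherits the parity of its boundary values by uniqueness. -/
theorem exists_deficiencySolution_of_parity (ha : 0 < a) (hV : IsPotential a V) (s : ℂ)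
    (hs : s * s = 1) :
    ∃ g, IsDeficiencySolution a V g ∧ ∀ x ∈ Icc (-a) a, g (-x) = s * g x := by
  obtain ⟨f, hf, he, hr, hl⟩ := exists_solution_dirichlet ha hV 1 s
  have hn := (isAC2_comp_neg ha hf).1
  have hn' := hn.smul ha (-s)
  -- `f` and `s f(-x)` solve the same Dirichlet problem
  have h0 := eqOn_zero_of_dirichlet ha hV (hf.add ha hn') (by
    filter_upwards [formalOp_add (V := V) ha hf hn', formalOp_smul (V := V) ha (-s) hn, he,
      formalOp_comp_neg ha hV hf he] with x h1 h2 h3 h4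
    rw [h1, Pi.add_apply, h2, Pi.smul_apply, h3, h4]
    simp only [Pi.add_apply, Pi.smul_apply, smul_eq_mul]
    ring) (by
      simp only [Pi.add_apply, Pi.smul_apply, smul_eq_mul, hr, hl]
      linear_combination -hs) (by
      simp only [Pi.add_apply, Pi.smul_apply, smul_eq_mul, hr, hl, neg_neg]
      ring)
  have hpar : ∀ x ∈ Icc (-a) a, f (-x) = s * f x := by
    intro x hx
    have := h0 hx
    simp only [Pi.add_apply, Pi.smul_apply, smul_eq_mul, Pi.zero_apply] at this
    linear_combination -s * this - f (-x) * hs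
  have hne : ‖hf.toL2‖ ≠ 0 := by
    intro h
    have h1 : hf.toL2 = 0 := norm_eq_zero.mp h
    have h2 := hf.eqOn_of_ae_eq ha isAC2_zero
      (hf.coeFn_toL2.symm.trans (by rw [h1]; exact Lp.coeFn_zero _ _ _)) (right_mem ha)
    rw [hr] at h2
    exact one_ne_zero h2
  have hc := hf.smul ha ((‖hf.toL2‖⁻¹ : ℝ) : ℂ)
  refine ⟨_, ⟨hc, ?_, ?_⟩, ?_⟩
  · filter_upwards [formalOp_smul (V := V) ha ((‖hf.toL2‖⁻¹ : ℝ) : ℂ) hf, he] with x h1 h2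
    rw [h1, Pi.smul_apply, h2, Pi.smul_apply]
    simp only [smul_eq_mul]
    ring
  · rw [← norm_toL2_sq hc, hf.toL2_smul ha, norm_smul, Complex.norm_real, norm_inv, norm_norm,
      inv_mul_cancel₀ hne, one_pow]
  · intro x hx
    simp only [Pi.smul_apply, smul_eq_mul, hpar x hx]
    ring

theorem exists_deficiencyPair (ha : 0 < a) (hV : IsPotential a V) :
    ∃ gp gm, IsDeficiencyPair a V gp gm := by
  obtain ⟨gp, hp, hp'⟩ := exists_deficiencySolution_of_parity ha hV 1 (by ring)
  obtain ⟨gm, hm, hm'⟩ := exists_deficiencySolution_of_parity ha hV (-1) (by ring)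
  exact ⟨gp, gm, hp, hm, by simpa using hp', by simpa using hm'⟩

theorem d1_neg_of_parity (ha : 0 < a) (hf : IsAC2 a f) {s : ℂ}
    (h : ∀ x ∈ Icc (-a) a, f (-x) = s * f x) : d1 a f (-a) = -(s * d1 a f a) := by
  have h1 := (isAC2_comp_neg ha hf).2.1 (right_mem ha)
  have h2 : EqOn (fun x => f (-x)) (s • f) (Icc (-a) a) := fun x hx => h x hx
  rw [d1_congr h2 (right_mem ha), hf.d1_smul s (right_mem ha), Pi.smul_apply, smul_eq_mul] at h1
  simp only at h1
  rw [h1, neg_neg]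

/-- The Wronskian of a normalized even or odd deficiency solution `g` and its conjugate. By Green's
formula its values at `±a`, which are opposite by parity, differ by `-2 i ‖g‖²`. -/
theorem IsDeficiencySolution.wronskian (ha : 0 < a) (hV : IsPotential a V)
    (hg : IsDeficiencySolution a V g) {s : ℂ} (hs : (starRingEnd ℂ) s * s = 1)
    (h : ∀ x ∈ Icc (-a) a, g (-x) = s * g x) :
    (starRingEnd ℂ) (g a) * d1 a g a - (starRingEnd ℂ) (d1 a g a) * g a = -Complex.I := by
  obtain ⟨_, e⟩ := (hg.toL2_mem_deficiencySpace ha hV).mpr hg.equation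
  rw [hg.adjoint_toL2 ha hV] at e
  have h1 := inner_opL2_sub ha hV hg.toIsAC2 hg.toIsAC2
  have hn : ((‖hg.toL2‖ : ℂ)) ^ 2 = 1 := by
    have := norm_toL2_sq hg.toIsAC2
    rw [hg.normalized] at this
    exact_mod_cast this
  rw [e, inner_smul_left, inner_smul_right, inner_self_eq_norm_sq_to_K, Complex.conj_I,
    d1_neg_of_parity ha hg.toIsAC2 h, h a (right_mem ha)] at h1
  simp only [Complex.coe_algebraMap, map_mul, map_neg] at h1
  rw [hn] at h1
  linear_combination -h1 / 2 - (1 / 2) * ((starRingEnd ℂ) (g a) * d1 a g a -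
    (starRingEnd ℂ) (d1 a g a) * g a) * hs

end Deficiency

/-! ### The boundary matrix -/

section BoundaryMatrix

variable {a : ℝ} {V : ℝ → ℝ} {gp gm : ℝ → ℂ} {U U' W : Matrix (Fin 2) (Fin 2) ℂ}

theorem conjMatrix_mul_conjTranspose (U : Matrix (Fin 2) (Fin 2) ℂ) :
    conjMatrix U * (conjMatrix U)ᴴ = conjMatrix (U * Uᴴ) := by
  ext i j
  simp [conjMatrix, Matrix.mul_apply]

theorem conjMatrix_conjMatrix (U : Matrix (Fin 2) (Fin 2) ℂ) : conjMatrix (conjMatrix U) = U := by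
  ext i j
  simp [conjMatrix]

theorem conjMatrix_one : conjMatrix 1 = 1 := by
  simp [conjMatrix]

theorem mem_unitaryGroup_iff_conjMatrix :
    U ∈ Matrix.unitaryGroup (Fin 2) ℂ ↔ conjMatrix U * (conjMatrix U)ᴴ = 1 := by
  rw [Matrix.mem_unitaryGroup_iff, Matrix.star_eq_conjTranspose, conjMatrix_mul_conjTranspose]
  constructor
  · intro h
    rw [h, conjMatrix_one]
  · intro h
    rw [← conjMatrix_conjMatrix (U * Uᴴ), h, conjMatrix_one]

/-- The coefficient `conj 𝒜 - i conj ℬ` of `matMinus`. -/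
noncomputable def leftCoeff (a : ℝ) (gp gm : ℝ → ℂ) : Matrix (Fin 2) (Fin 2) ℂ :=
  conjMatrix (matA a gp gm) - Complex.I • conjMatrix (matB a gp gm)

/-- The coefficient `𝒜 - i ℬ` of `matMinus`. -/
noncomputable def rightCoeff (a : ℝ) (gp gm : ℝ → ℂ) : Matrix (Fin 2) (Fin 2) ℂ :=
  matA a gp gm - Complex.I • matB a gp gm

theorem matMinus_eq (U : Matrix (Fin 2) (Fin 2) ℂ) :
    matMinus a gp gm U = leftCoeff a gp gm + conjMatrix U * rightCoeff a gp gm := rfl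

theorem matPlus_eq (U : Matrix (Fin 2) (Fin 2) ℂ) :
    matPlus a gp gm U = (rightCoeff a gp gm)ᴴ + conjMatrix U * (leftCoeff a gp gm)ᴴ := by
  have h1 : (rightCoeff a gp gm)ᴴ =
      conjMatrix (matA a gp gm) + Complex.I • conjMatrix (matB a gp gm) := by
    ext i j
    fin_cases i <;> fin_cases j <;> simp [rightCoeff, conjMatrix, matA, matB]
  have h2 : (leftCoeff a gp gm)ᴴ = matA a gp gm + Complex.I • matB a gp gm := by
    ext i j
    fin_cases i <;> fin_cases j <;> simp [leftCoeff, conjMatrix, matA, matB]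
  rw [h1, h2]
  rfl

theorem IsDeficiencyPair.wronskian_plus (ha : 0 < a) (hV : IsPotential a V)
    (h : IsDeficiencyPair a V gp gm) :
    (starRingEnd ℂ) (gp a) * d1 a gp a - (starRingEnd ℂ) (d1 a gp a) * gp a = -Complex.I :=
  h.plus.wronskian ha hV (s := 1) (by simp) (by simpa using h.even)

theorem IsDeficiencyPair.wronskian_minus (ha : 0 < a) (hV : IsPotential a V)
    (h : IsDeficiencyPair a V gp gm) :
    (starRingEnd ℂ) (gm a) * d1 a gm a - (starRingEnd ℂ) (d1 a gm a) * gm a = -Complex.I :=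
  h.minus.wronskian ha hV (s := -1) (by simp) (by simpa using h.odd)

theorem isHyperbolicPair_coeff (ha : 0 < a) (hV : IsPotential a V)
    (h : IsDeficiencyPair a V gp gm) :
    IsHyperbolicPair (leftCoeff a gp gm) (rightCoeff a gp gm) := by
  have hl : leftCoeff a gp gm = Matrix.diagonal
      ![(starRingEnd ℂ) (gp a) - Complex.I * (starRingEnd ℂ) (d1 a gp a),
        (starRingEnd ℂ) (gm a) - Complex.I * (starRingEnd ℂ) (d1 a gm a)] := by
    ext i j
    fin_cases i <;> fin_cases j <;> simp [leftCoeff, conjMatrix, matA, matB]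
  have hr : rightCoeff a gp gm = Matrix.diagonal
      ![gp a - Complex.I * d1 a gp a, gm a - Complex.I * d1 a gm a] := by
    ext i j
    fin_cases i <;> fin_cases j <;> simp [rightCoeff, matA, matB]
  have hp := h.wronskian_plus ha hV
  have hm := h.wronskian_minus ha hV
  have e : (2 : Matrix (Fin 2) (Fin 2) ℂ) = Matrix.diagonal fun _ => 2 := by
    ext i j
    fin_cases i <;> fin_cases j <;> rfl
  rw [hl, hr]
  refine ⟨?_, ?_, ?_, ?_, ?_⟩ <;>
    simp only [Matrix.diagonal_conjTranspose, Matrix.diagonal_mul_diagonal, e,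
      Matrix.diagonal_add, Matrix.diagonal_eq_diagonal_iff, Fin.forall_fin_two, Pi.star_apply,
      Matrix.cons_val_zero, Matrix.cons_val_one, RCLike.star_def, map_sub, map_mul,
      Complex.conj_conj, Complex.conj_I] <;>
    constructor
  all_goals try ring1
  · linear_combination 2 * Complex.I * hp - 2 * Complex.I_sq
  · linear_combination 2 * Complex.I * hm - 2 * Complex.I_sq

/-- The matrix taking a boundary vector to its combinations belonging to even and odd functions. It
is `√2` times a unitary matrix. -/
def parityMatrix : Matrix (Fin 2) (Fin 2) ℂ := !![1, -1; 1, 1]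

theorem parityMatrix_conjTranspose : parityMatrixᴴ = !![1, 1; -1, 1] := by
  ext i j
  fin_cases i <;> fin_cases j <;> simp [parityMatrix]

theorem parityMatrix_mul_conjTranspose : parityMatrix * parityMatrixᴴ = (2 : ℂ) • 1 := by
  rw [parityMatrix_conjTranspose, parityMatrix]
  ext i j
  fin_cases i <;> fin_cases j <;> simp [Matrix.mul_apply] <;> norm_num

theorem conjTranspose_mul_parityMatrix : parityMatrixᴴ * parityMatrix = (2 : ℂ) • 1 := by
  rw [parityMatrix_conjTranspose, parityMatrix]
  ext i j
  fin_cases i <;> fin_cases j <;> simp [Matrix.mul_apply] <;> norm_num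

theorem boundaryMatrix_eq (U : Matrix (Fin 2) (Fin 2) ℂ) :
    boundaryMatrix a gp gm U = (-(1 / 2) : ℂ) • (parityMatrixᴴ *
      ((matMinus a gp gm U)⁻¹ * matPlus a gp gm U) * parityMatrix) := by
  rw [parityMatrix_conjTranspose, boundaryMatrix, parityMatrix]
  simp only [mul_assoc]

theorem parity_conj_boundaryMatrix (U : Matrix (Fin 2) (Fin 2) ℂ) :
    (-(1 / 2) : ℂ) • (parityMatrix * boundaryMatrix a gp gm U * parityMatrixᴴ) =
      (matMinus a gp gm U)⁻¹ * matPlus a gp gm U := by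
  rw [boundaryMatrix_eq]
  set N := (matMinus a gp gm U)⁻¹ * matPlus a gp gm U
  have : parityMatrix * (parityMatrixᴴ * N * parityMatrix) * parityMatrixᴴ =
      (parityMatrix * parityMatrixᴴ) * N * (parityMatrix * parityMatrixᴴ) := by
    simp only [mul_assoc]
  rw [Matrix.mul_smul, Matrix.smul_mul, this, parityMatrix_mul_conjTranspose]
  simp only [Matrix.smul_mul, Matrix.mul_smul, one_mul, mul_one, smul_smul]
  norm_num

/-- Conjugation by the normalized parity matrix preserves unitarity. -/
theorem unitary_parity_conj (N : Matrix (Fin 2) (Fin 2) ℂ) :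
    (-(1 / 2) : ℂ) • (parityMatrixᴴ * N * parityMatrix) ∈ Matrix.unitaryGroup (Fin 2) ℂ ↔
      N * Nᴴ = 1 := by
  have key : ((-(1 / 2) : ℂ) • (parityMatrixᴴ * N * parityMatrix)) *
      ((-(1 / 2) : ℂ) • (parityMatrixᴴ * N * parityMatrix))ᴴ =
      (1 / 2 : ℂ) • (parityMatrixᴴ * (N * Nᴴ) * parityMatrix) := by
    have : (parityMatrixᴴ * N * parityMatrix) * (parityMatrixᴴ * N * parityMatrix)ᴴ =
        parityMatrixᴴ * N * (parityMatrix * parityMatrixᴴ) * Nᴴ * parityMatrix := by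
      simp only [Matrix.conjTranspose_mul, Matrix.conjTranspose_conjTranspose, mul_assoc]
    rw [Matrix.conjTranspose_smul, Matrix.smul_mul, Matrix.mul_smul, this,
      parityMatrix_mul_conjTranspose]
    simp only [Matrix.smul_mul, Matrix.mul_smul, mul_one, smul_smul, mul_assoc]
    congr 1
    simp
  rw [Matrix.mem_unitaryGroup_iff, Matrix.star_eq_conjTranspose, key]
  constructor
  · intro h
    have h2 := congrArg (fun Z => (1 / 2 : ℂ) • (parityMatrix * Z * parityMatrixᴴ)) h
    have : parityMatrix * (parityMatrixᴴ * (N * Nᴴ) * parityMatrix) * parityMatrixᴴ =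
        (parityMatrix * parityMatrixᴴ) * (N * Nᴴ) * (parityMatrix * parityMatrixᴴ) := by
      simp only [mul_assoc]
    simp only [Matrix.mul_smul, Matrix.smul_mul, this, parityMatrix_mul_conjTranspose, mul_one,
      one_mul, smul_smul] at h2
    norm_num at h2
    exact h2
  · intro h
    rw [h, mul_one, conjTranspose_mul_parityMatrix, smul_smul]
    norm_num

theorem isUnit_matMinus_matPlus (ha : 0 < a) (hV : IsPotential a V)
    (h : IsDeficiencyPair a V gp gm) (hU : U ∈ Matrix.unitaryGroup (Fin 2) ℂ) :
    IsUnit (matMinus a gp gm U) ∧ IsUnit (matPlus a gp gm U) := by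
  rw [matPlus_eq, matMinus_eq]
  exact (isHyperbolicPair_coeff ha hV h).isUnit (mem_unitaryGroup_iff_conjMatrix.mp hU)

theorem boundaryMatrix_mem_unitaryGroup_iff (ha : 0 < a) (hV : IsPotential a V)
    (h : IsDeficiencyPair a V gp gm) (hU : IsUnit (matMinus a gp gm U)) :
    boundaryMatrix a gp gm U ∈ Matrix.unitaryGroup (Fin 2) ℂ ↔
      U ∈ Matrix.unitaryGroup (Fin 2) ℂ := by
  rw [boundaryMatrix_eq, unitary_parity_conj, mem_unitaryGroup_iff_conjMatrix]
  rw [matMinus_eq] at hU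
  rw [matPlus_eq, matMinus_eq]
  exact (isHyperbolicPair_coeff ha hV h).unitary_iff hU

theorem bijOn_boundaryMatrix (ha : 0 < a) (hV : IsPotential a V)
    (h : IsDeficiencyPair a V gp gm) :
    BijOn (boundaryMatrix a gp gm)
      (Matrix.unitaryGroup (Fin 2) ℂ : Set (Matrix (Fin 2) (Fin 2) ℂ))
      (Matrix.unitaryGroup (Fin 2) ℂ : Set (Matrix (Fin 2) (Fin 2) ℂ)) := by
  have hp := isHyperbolicPair_coeff ha hV h
  refine ⟨fun U hU => ?_, fun U hU U' hU' e => ?_, fun W hW => ?_⟩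
  · exact (boundaryMatrix_mem_unitaryGroup_iff ha hV h
      (isUnit_matMinus_matPlus ha hV h hU).1).mpr hU
  · have h1 := (isUnit_matMinus_matPlus ha hV h hU).1
    have h2 := (isUnit_matMinus_matPlus ha hV h hU').1
    have e2 : (matMinus a gp gm U)⁻¹ * matPlus a gp gm U =
        (matMinus a gp gm U')⁻¹ * matPlus a gp gm U' := by
      rw [← parity_conj_boundaryMatrix, e, parity_conj_boundaryMatrix]
    rw [matMinus_eq] at h1 h2
    rw [matPlus_eq, matPlus_eq, matMinus_eq, matMinus_eq] at e2
    rw [← conjMatrix_conjMatrix U, hp.injective h1 h2 e2, conjMatrix_conjMatrix]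
  · set N := (-(1 / 2) : ℂ) • (parityMatrix * W * parityMatrixᴴ) with hN
    have hWN : (-(1 / 2) : ℂ) • (parityMatrixᴴ * N * parityMatrix) = W := by
      have : parityMatrixᴴ * (parityMatrix * W * parityMatrixᴴ) * parityMatrix =
          (parityMatrixᴴ * parityMatrix) * W * (parityMatrixᴴ * parityMatrix) := by
        simp only [mul_assoc]
      rw [hN, Matrix.mul_smul, Matrix.smul_mul, this, conjTranspose_mul_parityMatrix]
      simp only [Matrix.smul_mul, Matrix.mul_smul, one_mul, mul_one, smul_smul]
      norm_num
    have hNu : N * Nᴴ = 1 := by rwa [← unitary_parity_conj, hWN]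
    obtain ⟨X, hX, hXN⟩ := hp.surjective (mul_eq_one_comm.mp hNu)
    have hM : IsUnit (matMinus a gp gm (conjMatrix X)) := by
      rwa [matMinus_eq, conjMatrix_conjMatrix]
    have hb : boundaryMatrix a gp gm (conjMatrix X) = W := by
      rw [boundaryMatrix_eq, matMinus_eq, matPlus_eq, conjMatrix_conjMatrix, hXN, hWN]
    refine ⟨conjMatrix X, ?_, hb⟩
    rw [SetLike.mem_coe, ← boundaryMatrix_mem_unitaryGroup_iff ha hV h hM, hb]
    exact hW

end BoundaryMatrix

/-! ### Orthonormal bases of the deficiency spaces -/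

section Bases

variable {a : ℝ} {V : ℝ → ℝ} {f g gp gm : ℝ → ℂ}

theorem inner_toL2_eq_zero_of_parity (hf : IsAC2 a f) (hg : IsAC2 a g)
    (he : ∀ x ∈ Icc (-a) a, f (-x) = f x) (ho : ∀ x ∈ Icc (-a) a, g (-x) = -g x) :
    inner ℂ hf.toL2 hg.toL2 = 0 := by
  rw [inner_box hf.coeFn_toL2 hg.coeFn_toL2]
  have h1 := (measurePreserving_neg_box a).integral_comp
    (MeasurableEquiv.neg ℝ).measurableEmbedding (fun x => (starRingEnd ℂ) (f x) * g x)
  have h2 : ∫ x, (starRingEnd ℂ) (f (-x)) * g (-x) ∂boxMeasure a =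
      -∫ x, (starRingEnd ℂ) (f x) * g x ∂boxMeasure a := by
    rw [← integral_neg]
    refine integral_congr_ae ?_
    filter_upwards [ae_mem_box a] with x hx
    rw [he x hx, ho x hx, mul_neg]
  rw [h2] at h1
  exact self_eq_neg.mp h1.symm

/-- Two normalized vectors of opposite parity form an orthonormal basis of a deficiency space, as
its dimension is at most two. -/
theorem exists_orthonormalBasis (ha : 0 < a) (hV : IsPotential a V) {z : ℂ} (hz : z.im ≠ 0)
    (hf : IsAC2 a f) (hg : IsAC2 a g)
    (hfz : formalOp a V f =ᵐ[boxMeasure a] fun x => z * f x)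
    (hgz : formalOp a V g =ᵐ[boxMeasure a] fun x => z * g x)
    (nf : ∫ x, ‖f x‖ ^ 2 ∂boxMeasure a = 1) (ng : ∫ x, ‖g x‖ ^ 2 ∂boxMeasure a = 1)
    (he : ∀ x ∈ Icc (-a) a, f (-x) = f x) (ho : ∀ x ∈ Icc (-a) a, g (-x) = -g x) :
    ∃ b : OrthonormalBasis (Fin 2) ℂ (deficiencySpace (minimalOp ha hV) z),
      (b 0 : BoxL2 a) = hf.toL2 ∧ (b 1 : BoxL2 a) = hg.toL2 := by
  obtain ⟨hfin, hrank⟩ :=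
    (isBoundaryTriple_minimalOp ha hV).finrank_deficiencySpace_le hz
  let v : Fin 2 → deficiencySpace (minimalOp ha hV) z :=
    ![⟨_, (hf.toL2_mem_deficiencySpace ha hV).mpr hfz⟩,
      ⟨_, (hg.toL2_mem_deficiencySpace ha hV).mpr hgz⟩]
  have n1 : ‖hf.toL2‖ = 1 := by
    rw [← sq_eq_sq₀ (norm_nonneg _) zero_le_one, norm_toL2_sq, nf, one_pow]
  have n2 : ‖hg.toL2‖ = 1 := by
    rw [← sq_eq_sq₀ (norm_nonneg _) zero_le_one, norm_toL2_sq, ng, one_pow]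
  have o := inner_toL2_eq_zero_of_parity hf hg he ho
  have hv : Orthonormal ℂ v := by
    refine ⟨Fin.forall_fin_two.mpr ⟨n1, n2⟩, ?_⟩
    intro i j hij
    fin_cases i <;> fin_cases j
    · exact absurd rfl hij
    · exact o
    · exact inner_eq_zero_symm.mp o
    · exact absurd rfl hij
  have hcard : Fintype.card (Fin 2) = Module.finrank ℂ (deficiencySpace (minimalOp ha hV) z) :=
    le_antisymm hv.linearIndependent.fintype_card_le_finrank hrank
  have hsp := hv.linearIndependent.span_eq_top_of_card_eq_finrank' hcard
  refine ⟨OrthonormalBasis.mk hv hsp.ge, ?_, ?_⟩ <;> rw [OrthonormalBasis.coe_mk] <;> rfl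

variable {H : Type*} [NormedAddCommGroup H] [InnerProductSpace ℂ H] [CompleteSpace H]
  {T : H →ₗ.[ℂ] H}

theorem deficiencyMap_apply_basis (bp : OrthonormalBasis (Fin 2) ℂ (deficiencySpace T Complex.I))
    (bm : OrthonormalBasis (Fin 2) ℂ (deficiencySpace T (-Complex.I)))
    (U : Matrix (Fin 2) (Fin 2) ℂ) (j : Fin 2) :
    deficiencyMap bp bm U (bp j) = ∑ k, U j k • bm k := by
  have := bp.toBasis.constr_basis ℂ (fun j => ∑ k, U j k • bm k) j
  rwa [OrthonormalBasis.coe_toBasis] at this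

/-- The linear map with matrix `U` takes an orthonormal basis to an orthonormal family exactly when
the rows of `U` are orthonormal. -/
theorem norm_deficiencyMap_iff (bp : OrthonormalBasis (Fin 2) ℂ (deficiencySpace T Complex.I))
    (bm : OrthonormalBasis (Fin 2) ℂ (deficiencySpace T (-Complex.I)))
    (U : Matrix (Fin 2) (Fin 2) ℂ) :
    (∀ u, ‖deficiencyMap bp bm U u‖ = ‖u‖) ↔ U ∈ Matrix.unitaryGroup (Fin 2) ℂ := by
  have hinner : ∀ i j, inner ℂ (deficiencyMap bp bm U (bp i)) (deficiencyMap bp bm U (bp j)) =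
      (U * Uᴴ) j i := by
    intro i j
    rw [deficiencyMap_apply_basis, deficiencyMap_apply_basis, bm.orthonormal.inner_sum,
      Matrix.mul_apply]
    refine Finset.sum_congr rfl fun k _ => ?_
    rw [Matrix.conjTranspose_apply, mul_comm]
    rfl
  have hon : Orthonormal ℂ (deficiencyMap bp bm U ∘ bp) ↔ U ∈ Matrix.unitaryGroup (Fin 2) ℂ := by
    rw [orthonormal_iff_ite, Matrix.mem_unitaryGroup_iff, Matrix.star_eq_conjTranspose]
    constructor
    · intro h
      ext i j
      rw [← hinner j i, Matrix.one_apply]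
      exact (h j i).trans (by simp only [eq_comm])
    · intro h i j
      rw [Function.comp_apply, Function.comp_apply, hinner, h, Matrix.one_apply]
      simp only [eq_comm]
  rw [← hon]
  constructor
  · intro h
    exact bp.orthonormal.comp_linearIsometry ⟨deficiencyMap bp bm U, h⟩
  · intro h u
    have hbp : Orthonormal ℂ bp.toBasis := by rw [bp.coe_toBasis]; exact bp.orthonormal
    exact ((deficiencyMap bp bm U).isometryOfOrthonormal hbp
      (by rw [bp.coe_toBasis]; exact h)).norm_map u

end Bases

/-! ### The von Neumann extensions and their boundary conditions -/

section VonNeumann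

variable {a : ℝ} {V : ℝ → ℝ} {f g gp gm : ℝ → ℂ} {U : Matrix (Fin 2) (Fin 2) ℂ}

/-- The function `g_j + ∑ k, u_{jk} conj g_k`, where `g_1, g_2` are `gp, gm`. -/
noncomputable def pairSum (gp gm : ℝ → ℂ) (U : Matrix (Fin 2) (Fin 2) ℂ) (j : Fin 2) : ℝ → ℂ :=
  ![gp, gm] j + (U j 0 • (fun x => (starRingEnd ℂ) (gp x)) +
    U j 1 • (fun x => (starRingEnd ℂ) (gm x)))

theorem pairSum_apply (j : Fin 2) (x : ℝ) :
    pairSum gp gm U j x = ![gp, gm] j x +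
      (U j 0 * (starRingEnd ℂ) (gp x) + U j 1 * (starRingEnd ℂ) (gm x)) := rfl

theorem isAC2_pair (hg : IsDeficiencyPair a V gp gm) (j : Fin 2) : IsAC2 a (![gp, gm] j) := by
  fin_cases j
  · exact hg.plus.toIsAC2
  · exact hg.minus.toIsAC2

theorem isAC2_pairSum (ha : 0 < a) (hg : IsDeficiencyPair a V gp gm) (j : Fin 2) :
    IsAC2 a (pairSum gp gm U j) :=
  (isAC2_pair hg j).add ha (((isAC2_conj ha hg.plus.toIsAC2).1.smul ha _).add ha
    ((isAC2_conj ha hg.minus.toIsAC2).1.smul ha _))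

theorem d1_pairSum (ha : 0 < a) (hg : IsDeficiencyPair a V gp gm) (j : Fin 2) {x : ℝ}
    (hx : x ∈ Icc (-a) a) :
    d1 a (pairSum gp gm U j) x = d1 a (![gp, gm] j) x + (U j 0 * (starRingEnd ℂ) (d1 a gp x) +
      U j 1 * (starRingEnd ℂ) (d1 a gm x)) := by
  have c1 := isAC2_conj ha hg.plus.toIsAC2
  have c2 := isAC2_conj ha hg.minus.toIsAC2
  rw [pairSum, (isAC2_pair hg j).d1_add ((c1.1.smul ha _).add ha (c2.1.smul ha _)) hx, Pi.add_apply,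
    (c1.1.smul ha _).d1_add (c2.1.smul ha _) hx, Pi.add_apply, c1.1.d1_smul _ hx,
    c2.1.d1_smul _ hx, Pi.smul_apply, Pi.smul_apply, c1.2.1 hx, c2.2.1 hx, smul_eq_mul, smul_eq_mul]

/-- The matrix with columns `outVec a (pairSum gp gm U j)`. -/
noncomputable def outMatrix (a : ℝ) (gp gm : ℝ → ℂ) (U : Matrix (Fin 2) (Fin 2) ℂ) :
    Matrix (Fin 2) (Fin 2) ℂ :=
  Matrix.of fun i j => outVec a (pairSum gp gm U j) i

/-- The matrix with columns `inVec a (pairSum gp gm U j)`. -/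
noncomputable def inMatrix (a : ℝ) (gp gm : ℝ → ℂ) (U : Matrix (Fin 2) (Fin 2) ℂ) :
    Matrix (Fin 2) (Fin 2) ℂ :=
  Matrix.of fun i j => inVec a (pairSum gp gm U j) i

/-- In even and odd coordinates, the boundary vectors of the functions spanning a von Neumann
extension are the rows of the conjugates of `matMinus` and `matPlus`. -/
theorem parityMatrix_mul_outMatrix_inMatrix (ha : 0 < a) (hg : IsDeficiencyPair a V gp gm) :
    parityMatrix * outMatrix a gp gm U = (-2 * Complex.I) • (matMinus a gp gm U)ᴴ ∧
    parityMatrix * inMatrix a gp gm U = (2 * Complex.I) • (matPlus a gp gm U)ᴴ := by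
  have hp := hg.even a (right_mem ha)
  have hm := hg.odd a (right_mem ha)
  have hp' := d1_neg_of_parity (s := 1) ha hg.plus.toIsAC2 (by simpa using hg.even)
  have hm' := d1_neg_of_parity (s := -1) ha hg.minus.toIsAC2 (by simpa using hg.odd)
  constructor
  all_goals
    ext i j
    fin_cases i <;> fin_cases j <;>
    simp [parityMatrix, outMatrix, inMatrix, outVec, inVec, matMinus, matPlus, conjMatrix, matA,
      matB, Matrix.mul_apply, d1_pairSum ha hg _ (right_mem ha), d1_pairSum ha hg _ (left_mem ha),
      pairSum_apply, hp, hm, hp', hm'] <;>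
    ring_nf <;> simp only [Complex.I_sq] <;> ring

/-- The functions `pairSum gp gm U j` satisfy the boundary condition with matrix
`boundaryMatrix a gp gm U`; this uses that the Gram matrices of `matMinus` and `matPlus` agree. -/
theorem boundaryMatrix_mul_inMatrix (ha : 0 < a) (hV : IsPotential a V)
    (hg : IsDeficiencyPair a V gp gm) (hU : U ∈ Matrix.unitaryGroup (Fin 2) ℂ) :
    boundaryMatrix a gp gm U * inMatrix a gp gm U = outMatrix a gp gm U := by
  obtain ⟨h1, h2⟩ := parityMatrix_mul_outMatrix_inMatrix (U := U) ha hg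
  have hgram : matPlus a gp gm U * (matPlus a gp gm U)ᴴ =
      matMinus a gp gm U * (matMinus a gp gm U)ᴴ := by
    have := (isHyperbolicPair_coeff ha hV hg).gram_identity (conjMatrix U)
    rw [mem_unitaryGroup_iff_conjMatrix.mp hU, sub_self, smul_zero, sub_eq_zero] at this
    rw [matPlus_eq, matMinus_eq, this]
  have hdet := (Matrix.isUnit_iff_isUnit_det _).mp (isUnit_matMinus_matPlus ha hV hg hU).1
  have h3 : (parityMatrixᴴ * parityMatrix) * outMatrix a gp gm U =
      (-2 * Complex.I) • (parityMatrixᴴ * (matMinus a gp gm U)ᴴ) := by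
    rw [mul_assoc, h1, Matrix.mul_smul]
  rw [conjTranspose_mul_parityMatrix, Matrix.smul_mul, one_mul] at h3
  have h4 : outMatrix a gp gm U = (-Complex.I) • (parityMatrixᴴ * (matMinus a gp gm U)ᴴ) := by
    apply smul_right_injective _ (two_ne_zero (α := ℂ))
    simp only [h3, smul_smul]
    congr 1
    ring
  rw [h4, boundaryMatrix_eq, Matrix.smul_mul, mul_assoc, h2, Matrix.mul_smul, smul_smul,
    mul_assoc, mul_assoc, hgram, ← mul_assoc _ (matMinus a gp gm U),
    Matrix.nonsing_inv_mul _ hdet, one_mul]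
  congr 1
  ring

theorem isUnit_inMatrix (ha : 0 < a) (hV : IsPotential a V)
    (hg : IsDeficiencyPair a V gp gm) (hU : U ∈ Matrix.unitaryGroup (Fin 2) ℂ) :
    IsUnit (inMatrix a gp gm U) := by
  have h2 := (parityMatrix_mul_outMatrix_inMatrix (U := U) ha hg).2
  have hu : IsUnit (parityMatrix * inMatrix a gp gm U) := by
    rw [h2, Matrix.isUnit_iff_isUnit_det, Matrix.det_smul, Matrix.det_conjTranspose]
    refine IsUnit.mul (by simp) ?_
    exact ((Matrix.isUnit_iff_isUnit_det _).mp (isUnit_matMinus_matPlus ha hV hg hU).2).star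
  rw [Matrix.isUnit_iff_isUnit_det, Matrix.det_mul] at hu
  exact (Matrix.isUnit_iff_isUnit_det _).mpr (isUnit_of_mul_isUnit_right hu)

variable (ha : 0 < a) (hV : IsPotential a V)
  (bp : OrthonormalBasis (Fin 2) ℂ (deficiencySpace (minimalOp ha hV) Complex.I))
  (bm : OrthonormalBasis (Fin 2) ℂ (deficiencySpace (minimalOp ha hV) (-Complex.I)))

/-- The domain of the von Neumann extension given by a unitary matrix `U` is described by the
boundary condition with matrix `boundaryMatrix a gp gm U`. -/
theorem mem_vonNeumannDomain_iff (hg : IsDeficiencyPair a V gp gm)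
    (hp : ∀ j, (bp j : BoxL2 a) = (isAC2_pair hg j).toL2)
    (hm0 : (bm 0 : BoxL2 a) = (isAC2_conj ha hg.plus.toIsAC2).1.toL2)
    (hm1 : (bm 1 : BoxL2 a) = (isAC2_conj ha hg.minus.toIsAC2).1.toL2)
    (hU : U ∈ Matrix.unitaryGroup (Fin 2) ℂ) (f : (minimalOp ha hV)†.domain) :
    (f : BoxL2 a) ∈ vonNeumannDomain (minimalOp ha hV) (deficiencyMap bp bm U) ↔
      outMap ha hV f = boundaryMatrix a gp gm U *ᵥ inMap ha hV f := by
  have hΓ := isBoundaryTriple_minimalOp ha hV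
  set Φ := deficiencyMap bp bm U
  set W := boundaryMatrix a gp gm U
  have hw : ∀ j, (bp j : BoxL2 a) + Φ (bp j) = (isAC2_pairSum (U := U) ha hg j).toL2 := by
    intro j
    rw [deficiencyMap_apply_basis, Fin.sum_univ_two, hp, Submodule.coe_add, Submodule.coe_smul,
      Submodule.coe_smul, hm0, hm1]
    rfl
  let w : Fin 2 → (minimalOp ha hV)†.domain := fun j =>
    ⟨_, (isAC2_pairSum (U := U) ha hg j).toL2_mem_adjoint ha hV⟩
  have hout : ∀ j, outMap ha hV (w j) = (outMatrix a gp gm U).col j := fun j =>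
    outMap_eq ha hV _ (isAC2_pairSum ha hg j) rfl
  have hin : ∀ j, inMap ha hV (w j) = (inMatrix a gp gm U).col j := fun j =>
    inMap_eq ha hV _ (isAC2_pairSum ha hg j) rfl
  have hWw : ∀ j, outMap ha hV (w j) = W *ᵥ inMap ha hV (w j) := by
    intro j
    rw [hout, hin, ← boundaryMatrix_mul_inMatrix ha hV hg hU]
    rfl
  constructor
  · intro hf
    let K : Submodule ℂ (minimalOp ha hV)†.domain :=
      LinearMap.ker (outMap ha hV - W.mulVecLin ∘ₗ inMap ha hV)
    have hK : ∀ u, u ∈ K ↔ outMap ha hV u = W *ᵥ inMap ha hV u := fun u => by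
      rw [← sub_eq_zero]
      rfl
    have hle : vonNeumannDomain (minimalOp ha hV) Φ ≤ K.map (minimalOp ha hV)†.domain.subtype := by
      refine sup_le (fun x hx => ?_) ?_
      · have hx' := (closure_le_adjoint hΓ.dense hΓ.symm).1 hx
        refine ⟨⟨x, hx'⟩, ?_, rfl⟩
        obtain ⟨h1, h2⟩ := hΓ.eq_zero_of_mem_closure ⟨x, hx'⟩ hx
        rw [SetLike.mem_coe, hK, h1, h2, Matrix.mulVec_zero]
      · rintro _ ⟨u, rfl⟩
        rw [← bp.sum_repr u, map_sum]
        refine Submodule.sum_mem _ fun j _ => ?_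
        rw [map_smul]
        refine Submodule.smul_mem _ _ ⟨w j, (hK _).mpr (hWw j), ?_⟩
        exact (hw j).symm
    obtain ⟨u, hu, e⟩ := hle hf
    obtain rfl : u = f := Subtype.ext e
    exact (hK _).mp hu
  · intro hf
    have hdet := (Matrix.isUnit_iff_isUnit_det _).mp (isUnit_inMatrix ha hV hg hU)
    -- subtract the combination of the `w j` with the same incoming boundary vector
    set c := (inMatrix a gp gm U)⁻¹ *ᵥ inMap ha hV f with hc
    have hinf : inMap ha hV f = ∑ j, c j • inMap ha hV (w j) := by
      have h1 : inMatrix a gp gm U *ᵥ c = inMap ha hV f := by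
        rw [hc, Matrix.mulVec_mulVec, Matrix.mul_nonsing_inv _ hdet, Matrix.one_mulVec]
      rw [← h1, Matrix.mulVec_eq_sum]
      refine Finset.sum_congr rfl fun j _ => ?_
      rw [hin, op_smul_eq_smul]
      rfl
    have houtf : outMap ha hV f = ∑ j, c j • outMap ha hV (w j) := by
      rw [hf, hinf, Matrix.mulVec_sum]
      refine Finset.sum_congr rfl fun j _ => ?_
      rw [Matrix.mulVec_smul, hWw]
    have hmem := hΓ.mem_domain (f - ∑ j, c j • w j)
      (by simp only [map_sub, map_sum, map_smul, ← houtf, sub_self])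
      (by simp only [map_sub, map_sum, map_smul, ← hinf, sub_self])
    have e : (f : BoxL2 a) = ((f - ∑ j, c j • w j : (minimalOp ha hV)†.domain) : BoxL2 a) +
        ∑ j, c j • ((bp j : BoxL2 a) + Φ (bp j)) := by
      simp only [hw]
      rw [AddSubgroupClass.coe_sub, Submodule.coe_sum]
      simp [w]
    rw [e]
    refine Submodule.add_mem_sup ((minimalOp ha hV).le_closure.1 hmem) ?_
    exact Submodule.sum_mem _ fun j _ => Submodule.smul_mem _ _ ⟨bp j, rfl⟩

end VonNeumann
end BoxSchrodinger

/-! ### Parametrization of the self-adjoint extensions -/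

theorem mainTheorem1 (a : ℝ) (ha : 0 < a) (V : ℝ → ℝ) (hV : BoxSchrodinger.IsPotential a V) :
    (∃ gp gm : ℝ → ℂ, BoxSchrodinger.IsDeficiencyPair a V gp gm) ∧
    ∀ gp gm : ℝ → ℂ, BoxSchrodinger.IsDeficiencyPair a V gp gm →
      -- invertibility, unitarity and bijectivity for the explicit matrix `𝒰`
      (∀ U ∈ Matrix.unitaryGroup (Fin 2) ℂ,
        IsUnit (BoxSchrodinger.matMinus a gp gm U) ∧ IsUnit (BoxSchrodinger.matPlus a gp gm U)) ∧
      (∀ U : Matrix (Fin 2) (Fin 2) ℂ, IsUnit (BoxSchrodinger.matMinus a gp gm U) →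
        (BoxSchrodinger.boundaryMatrix a gp gm U ∈ Matrix.unitaryGroup (Fin 2) ℂ ↔
          U ∈ Matrix.unitaryGroup (Fin 2) ℂ)) ∧
      Set.BijOn (BoxSchrodinger.boundaryMatrix a gp gm)
        (Matrix.unitaryGroup (Fin 2) ℂ : Set (Matrix (Fin 2) (Fin 2) ℂ))
        (Matrix.unitaryGroup (Fin 2) ℂ : Set (Matrix (Fin 2) (Fin 2) ℂ)) ∧
      -- the deficiency spaces and the self-adjoint extensions `A_U`
      ∃ (bp : OrthonormalBasis (Fin 2) ℂ
            (BoxSchrodinger.deficiencySpace (BoxSchrodinger.minimalOp ha hV) Complex.I))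
        (bm : OrthonormalBasis (Fin 2) ℂ
            (BoxSchrodinger.deficiencySpace (BoxSchrodinger.minimalOp ha hV) (-Complex.I))),
        ((bp 0 : BoxSchrodinger.BoxL2 a) =ᵐ[BoxSchrodinger.boxMeasure a] gp) ∧
        ((bp 1 : BoxSchrodinger.BoxL2 a) =ᵐ[BoxSchrodinger.boxMeasure a] gm) ∧
        ((bm 0 : BoxSchrodinger.BoxL2 a) =ᵐ[BoxSchrodinger.boxMeasure a]
          fun x => (starRingEnd ℂ) (gp x)) ∧
        ((bm 1 : BoxSchrodinger.BoxL2 a) =ᵐ[BoxSchrodinger.boxMeasure a]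
          fun x => (starRingEnd ℂ) (gm x)) ∧
        (∀ U : Matrix (Fin 2) (Fin 2) ℂ,
          (∀ u, ‖BoxSchrodinger.deficiencyMap bp bm U u‖ = ‖u‖) ↔
            U ∈ Matrix.unitaryGroup (Fin 2) ℂ) ∧
        Set.BijOn
          (fun U => BoxSchrodinger.vonNeumannExtension (BoxSchrodinger.minimalOp ha hV)
            (BoxSchrodinger.deficiencyMap bp bm U))
          (Matrix.unitaryGroup (Fin 2) ℂ : Set (Matrix (Fin 2) (Fin 2) ℂ))
          {B | BoxSchrodinger.minimalOp ha hV ≤ B ∧ IsSelfAdjoint B} ∧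
        ∀ U ∈ Matrix.unitaryGroup (Fin 2) ℂ,
          ((BoxSchrodinger.vonNeumannExtension (BoxSchrodinger.minimalOp ha hV)
              (BoxSchrodinger.deficiencyMap bp bm U)).domain : Set (BoxSchrodinger.BoxL2 a)) =
            BoxSchrodinger.bcDomain a (BoxSchrodinger.boundaryMatrix a gp gm U) := by
  refine ⟨BoxSchrodinger.exists_deficiencyPair ha hV, fun gp gm hg => ?_⟩
  obtain ⟨bp, hp0, hp1⟩ := BoxSchrodinger.exists_orthonormalBasis ha hV (z := Complex.I) (by simp)
    hg.plus.toIsAC2 hg.minus.toIsAC2 hg.plus.equation hg.minus.equation hg.plus.normalized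
    hg.minus.normalized hg.even hg.odd
  have cp := BoxSchrodinger.isAC2_conj ha hg.plus.toIsAC2
  have cm := BoxSchrodinger.isAC2_conj ha hg.minus.toIsAC2
  obtain ⟨bm, hm0, hm1⟩ := BoxSchrodinger.exists_orthonormalBasis ha hV (z := -Complex.I) (by simp)
    cp.1 cm.1 (by simpa using BoxSchrodinger.formalOp_conj ha hg.plus.toIsAC2 hg.plus.equation)
    (by simpa using BoxSchrodinger.formalOp_conj ha hg.minus.toIsAC2 hg.minus.equation)
    (by simpa using hg.plus.normalized) (by simpa using hg.minus.normalized)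
    (fun x hx => by rw [hg.even x hx]) (fun x hx => by rw [hg.odd x hx, map_neg])
  have hp : ∀ j, (bp j : BoxSchrodinger.BoxL2 a) = (BoxSchrodinger.isAC2_pair hg j).toL2 :=
    Fin.forall_fin_two.mpr ⟨hp0, hp1⟩
  have hΓ := BoxSchrodinger.isBoundaryTriple_minimalOp ha hV
  have hbij := BoxSchrodinger.bijOn_boundaryMatrix ha hV hg
  have hdom : ∀ U ∈ Matrix.unitaryGroup (Fin 2) ℂ,
      ∀ f : (BoxSchrodinger.minimalOp ha hV)†.domain,
        (f : BoxSchrodinger.BoxL2 a) ∈ (BoxSchrodinger.vonNeumannExtension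
          (BoxSchrodinger.minimalOp ha hV) (BoxSchrodinger.deficiencyMap bp bm U)).domain ↔
        BoxSchrodinger.outMap ha hV f =
          BoxSchrodinger.boundaryMatrix a gp gm U *ᵥ BoxSchrodinger.inMap ha hV f := by
    intro U hU f
    rw [BoxSchrodinger.vonNeumannExtension_domain hΓ.dense hΓ.symm]
    exact BoxSchrodinger.mem_vonNeumannDomain_iff ha hV bp bm hg hp hm0 hm1 hU f
  have hle : ∀ U, BoxSchrodinger.vonNeumannExtension (BoxSchrodinger.minimalOp ha hV)
      (BoxSchrodinger.deficiencyMap bp bm U) ≤ (BoxSchrodinger.minimalOp ha hV)† := fun U =>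
    LinearPMap.domRestrict_le
  refine ⟨fun U hU => BoxSchrodinger.isUnit_matMinus_matPlus ha hV hg hU,
    fun U hU => BoxSchrodinger.boundaryMatrix_mem_unitaryGroup_iff ha hV hg hU, hbij,
    bp, bm, ?_, ?_, ?_, ?_, BoxSchrodinger.norm_deficiencyMap_iff bp bm, ⟨?_, ?_, ?_⟩, ?_⟩
  · rw [hp0]
    exact hg.plus.coeFn_toL2
  · rw [hp1]
    exact hg.minus.coeFn_toL2
  · rw [hm0]
    exact cp.1.coeFn_toL2
  · rw [hm1]
    exact cm.1.coeFn_toL2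
  · intro U hU
    exact hΓ.isSelfAdjoint_of_domain (hle U) (hbij.mapsTo hU) (hdom U hU)
  · -- the domain determines the boundary matrix, as the boundary values are arbitrary
    intro U hU U' hU' e
    simp only at e
    refine hbij.injOn hU hU' ?_
    have key : ∀ y : Fin 2 → ℂ, BoxSchrodinger.boundaryMatrix a gp gm U *ᵥ y =
        BoxSchrodinger.boundaryMatrix a gp gm U' *ᵥ y := by
      intro y
      obtain ⟨f, h1, h2⟩ := hΓ.surj (BoxSchrodinger.boundaryMatrix a gp gm U *ᵥ y) y
      have hf := (hdom U hU f).mpr (by rw [h1, h2])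
      rw [e] at hf
      have := (hdom U' hU' f).mp hf
      rwa [h1, h2] at this
    exact Matrix.mulVec_injective (funext key)
  · rintro B ⟨hTB, hB⟩
    obtain ⟨hBT, W, hW, hBW⟩ := hΓ.exists_unitary_of_isSelfAdjoint hTB hB
    obtain ⟨U, hU, rfl⟩ := hbij.surjOn hW
    refine ⟨U, hU, BoxSchrodinger.eq_of_le_of_le (hle U) hBT (Submodule.ext fun x => ?_)⟩
    constructor
    · intro hx
      exact (hBW ⟨x, (hle U).1 hx⟩).mpr ((hdom U hU ⟨x, (hle U).1 hx⟩).mp hx)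
    · intro hx
      exact (hdom U hU ⟨x, hBT.1 hx⟩).mpr ((hBW ⟨x, hBT.1 hx⟩).mp hx)
  · intro U hU
    ext u
    constructor
    · intro hu
      have hu' := (hle U).1 hu
      obtain ⟨f, hf, huf⟩ := BoxSchrodinger.exists_isAC2_of_mem_adjoint ha hV ⟨u, hu'⟩
      have h := (hdom U hU ⟨u, hu'⟩).mp hu
      rw [BoxSchrodinger.outMap_eq ha hV _ hf huf, BoxSchrodinger.inMap_eq ha hV _ hf huf] at h
      refine ⟨f, hf, ?_, h⟩
      rw [show u = hf.toL2 from huf]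
      exact hf.coeFn_toL2
    · rintro ⟨f, hf, huf, hbc⟩
      obtain rfl : u = hf.toL2 := MeasureTheory.Lp.ext (huf.trans hf.coeFn_toL2.symm)
      refine (hdom U hU ⟨_, hf.toL2_mem_adjoint ha hV⟩).mpr ?_
      rw [BoxSchrodinger.outMap_eq ha hV _ hf rfl, BoxSchrodinger.inMap_eq ha hV _ hf rfl]
      exact hbc
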